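/- **Divergence and mixtures.** For distributions $P \ll Q$ and $\alpha \ge 0$ let $H_\alpha(P\|Q) = \int \max\{\frac{dP}{dQ}-\alpha,\,0\}\,dQ$. Let $\mathcal N(\mu,\sigma)$ be the univariate Gaussian with mean $\mu$ and standard deviation $\sigma$. **Setting.** Let $L, L_C, L_F, N, \Lambda, D$ be natural numbers with $L_F \ge 1$, $L - L_F + 1 \ge L_C + L_F$, $1 \le \Lambda \le N$ and $D \ge 1$. Let $C > 0$ (clipping norm), $\sigma > 0$ (noise scale), $\eta \in \mathbb R$ (learning rate) and $\theta_0 \in \mathbb R^D$ (initial parameters). A dataset $x = \{x_1,\dots,x_N\}$ consists of $N$ distinct series $x_n \in \mathbb R^L$. Two datasets are $1$-event-level neighbouring, $x \simeq x'$, if $x_n \ne x'_n$ for exactly one $n$, and these two series differ in exactly one time index. A model is a parametric map $f_\theta$, $\theta\in\mathbb R^D$, from contexts in $\mathbb R^{L_C}$ to an arbitrary output space, with a loss $\mathcal L$ such that $\theta \mapsto \mathcal L(f_\theta(c), y)$ is differentiable for all $c \in \mathbb R^{L_C}$, $y \in \mathbb R^{L_F}$. **Mechanism (one epoch, $\lambda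 = 1$).** Run steps $b = 1,\dots,K$ with $K = \lfloor N/\Lambda\rfloor$, starting from $\theta_0$. Step $b$ uses the sequences $x_n$ with $(b-1)\Lambda < n \le b\Lambda$ (deterministic top-level iteration). For each of them, prepend $L_C$ zeros to $x_n$, draw $t$ uniformly from $\{1,\dots,L-L_F+1\}$, independently over all sequences, and take the subsequence of length $L_C + L_F$ starting at $t$. Its first $L_C$ entries are the context $c$ and its last $L_F$ entries are the forecast target $y$. Let $g = \nabla_\theta \mathcal L(f_\theta(c), y)$ at the current parameters $\theta_{b-1}$, and let $\hat g$ be the sum over the batch (with multiplicity) of the clipped gradients $g / \max\{1, \|g\|_2/C\}$. Release $\tilde g_b = \frac1\Lambda\left(\hat g + Z_b\right)$, where the $Z_b \sim \mathcal N(0, \sigma^2C^2 I_D)$ are independent of each other and of the sampling, and set $\theta_b = \theta_{b-1} - \eta \tilde g_b$. The output of the epoch mechanism $M$ is $(\tilde g_1,\dots,\tilde g_K) \in \mathbb R^{K\times D}$, and $M_x$ is its law on dataset $x$. **Theorem.** Let $r = \frac{L_C+L_F}{L-L_F+1}$ and let $P(1) = (1-r)\,\mathcal N(0,\sigma) + r\,\mathcal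 N(2,\sigma)$. For a model $f$ (with its loss) let $H_f(\alpha) = \sup_{x\simeq x'} H_\alpha(M_x\|M_{x'})$ be the per-epoch privacy profile. Then for all $\alpha \ge 0$ the worst-case profile over all models is $$\sup_f H_f(\alpha) = \begin{cases} H_\alpha(P(1)\,\|\,\mathcal N(0,\sigma)) & \text{if } \alpha \ge 1,\\ H_\alpha(\mathcal N(0,\sigma)\,\|\,P(1)) & \text{if } 0 \le \alpha < 1.\end{cases}$$ Moreover, the bound is tight for a single model: there is a model $f$ for which $H_f(\alpha)$ equals the right-hand side for all $\alpha \ge 0$ simultaneously. -/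

import Mathlib

open MeasureTheory ProbabilityTheory
open scoped ENNReal NNReal

noncomputable section

namespace DPForecast

/-! ### Divergences and mixtures -/

/-- The hockey-stick divergence `H_α(P‖Q) = ∫ max {dP/dQ - α, 0} dQ` (for `P ≪ Q`), with values in
`[0, ∞]`; subtraction in `ℝ≥0∞` is truncated at `0`, so it is the positive part. -/
def hockeyStick {Ω : Type*} [MeasurableSpace Ω] (α : ℝ≥0) (P Q : Measure Ω) : ℝ≥0∞ :=
  ∫⁻ o, (P.rnDeriv Q o - (α : ℝ≥0∞)) ∂Q

/-- The univariate Gaussian mixture with means `μ`, weights `p` and standard deviation `σ`. -/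
def MoG {K : ℕ} (μ p : Fin K → ℝ) (σ : ℝ≥0) : Measure ℝ :=
  ∑ k, ENNReal.ofReal (p k) • gaussianReal (μ k) (σ ^ 2)

/-! ### Time series datasets -/

/-- A univariate time series of length `L`. -/
abbrev Series (L : ℕ) : Type := Fin L → ℝ

/-- A dataset `x = {x_1, …, x_N}` of `N` distinct series, in the order in which it is iterated. -/
abbrev Dataset (N L : ℕ) : Type := Fin N ↪ Series L

/-- `w`-event-level neighbours: exactly one pair of sequences `x_n, x'_n` differs, and it differs
only inside a range of `w` consecutive indices. -/
def EventNeighbor {N L : ℕ} (w : ℕ) (x x' : Dataset N L) : Prop :=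
  ∃ n : Fin N, (∀ m, m ≠ n → x m = x' m) ∧ x n ≠ x' n ∧
    ∃ t : ℕ, ∀ s : Fin L, x n s ≠ x' n s → t ≤ (s : ℕ) ∧ (s : ℕ) < t + w

/-- The series with `LC` zeros prepended, with 0-based positions `0, …, LC + L - 1`. (Positions
beyond the end, which no subsequence reaches, carry the value `0`.) -/
def padded {L : ℕ} (LC : ℕ) (a : Series L) (j : ℕ) : ℝ :=
  if h : LC ≤ j ∧ j - LC < L then a ⟨j - LC, h.2⟩ else 0

/-- Context window (first `LC` entries) of the subsequence starting at `t`. -/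
def contextWindow {L : ℕ} (LC : ℕ) (a : Series L) (t : ℕ) : Fin LC → ℝ :=
  fun i => padded LC a (t + i)

/-- Forecast window (last `LF` entries) of the subsequence starting at `t`. -/
def forecastWindow {L : ℕ} (LC LF : ℕ) (a : Series L) (t : ℕ) : Fin LF → ℝ :=
  fun i => padded LC a (t + LC + i)

/-! ### Models, clipped gradients, noisy training steps -/

/-- The parameter and gradient space `ℝ^D` with its Euclidean norm. -/
abbrev Param (D : ℕ) : Type := EuclideanSpace ℝ (Fin D)

/-- A parametric forecasting model `f_θ`, which maps a context window to an arbitrary output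
(for example the parameters of a distribution), with a loss that compares the output with the
ground-truth forecast window and is differentiable in `θ`. -/
structure ForecastModel (D LC LF : ℕ) where
  /-- the space of model outputs -/
  Out : Type
  /-- the model `(θ, context) ↦ f_θ(context)` -/
  predict : Param D → (Fin LC → ℝ) → Out
  /-- the loss of an output against the true forecast window -/
  loss : Out → (Fin LF → ℝ) → ℝ
  /-- the gradient of the loss with respect to the parameters exists -/
  differentiable_loss : ∀ c y, Differentiable ℝ fun θ => loss (predict θ c) y

/-- The per-subsequence gradient `∇_θ loss(f_θ(c), y)`. -/
def ForecastModel.grad {D LC LF : ℕ} (m : ForecastModel D LC LF) (θ : Param D)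
    (c : Fin LC → ℝ) (y : Fin LF → ℝ) : Param D :=
  gradient (fun ϑ => m.loss (m.predict ϑ c) y) θ

/-- Gradient clipping `g / max {1, ‖g‖₂ / C}`. -/
def clip {D : ℕ} (C : ℝ) (g : Param D) : Param D :=
  (max 1 (‖g‖ / C))⁻¹ • g

/-- Deterministic top-level iteration: the (0-based) `b`-th top-level batch consists of the
sequences with indices `b * N', …, (b + 1) * N' - 1`. -/
def topLevelBatch (N N' b : ℕ) : Finset (Fin N) :=
  Finset.univ.filter fun n => b * N' ≤ (n : ℕ) ∧ (n : ℕ) < (b + 1) * N'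

/-- Possible outcomes of bottom-level sampling with replacement for a top-level batch `B`: for each
sequence in `B`, `lam` start indices among the `L - LF + 1` possible ones. -/
abbrev StartIndices {N : ℕ} (L LF lam : ℕ) (B : Finset (Fin N)) : Type :=
  B → Fin lam → Fin (L - LF + 1)

/-- The sum of the clipped gradients over all sampled subsequences (with multiplicity). -/
def clippedSum {N L D LC LF : ℕ} (m : ForecastModel D LC LF) (C : ℝ) (x : Dataset N L)
    {lam : ℕ} (B : Finset (Fin N)) (τ : StartIndices L LF lam B) (θ : Param D) : Param D :=
  ∑ n : B, ∑ j : Fin lam,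
    clip C (m.grad θ (contextWindow LC (x n) (τ n j)) (forecastWindow LC LF (x n) (τ n j)))

/-- The law of the released noisy gradient `(1 / Λ) (ĝ + N(0, σ² C² I))` of one training step, where
all start indices are independent and uniform. -/
def stepLaw {N L D LC LF : ℕ} (m : ForecastModel D LC LF) (lam Lam : ℕ) (C : ℝ) (σ : ℝ≥0)
    (x : Dataset N L) (B : Finset (Fin N)) (θ : Param D) : Measure (Param D) :=
  (Fintype.card (StartIndices L LF lam B) : ℝ≥0∞)⁻¹ •
    ∑ τ : StartIndices L LF lam B,
      (stdGaussian (Param D)).map fun z =>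
        (Lam : ℝ)⁻¹ • (clippedSum m C x B τ θ + ((σ : ℝ) * C) • z)

/-- The joint law of the noisy gradients released in the `k` consecutive training steps
`b, b + 1, …, b + k - 1`, started at parameters `θ`: a noisy gradient `g` is drawn, the parameters
are updated to `θ - η g`, and the remaining steps are run from there. -/
def stepsLaw {N L D LC LF : ℕ} (m : ForecastModel D LC LF) (lam Lam : ℕ) (C : ℝ) (σ : ℝ≥0) (η : ℝ)
    (x : Dataset N L) : (k b : ℕ) → Param D → Measure (Fin k → Param D)
  | 0, _, _ => Measure.dirac Fin.elim0
  | k + 1, b, θ =>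
    (stepLaw m lam Lam C σ x (topLevelBatch N (Lam / lam) b) θ).bind fun g =>
      (stepsLaw m lam Lam C σ η x k (b + 1) (θ - η • g)).map
        (fun o => (Fin.cons g o : Fin (k + 1) → Param D))

/-- The epoch mechanism `M`: its output is the sequence of all `⌊N λ / Λ⌋` noisy gradients. -/
def epochLaw {N L D LC LF : ℕ} (m : ForecastModel D LC LF) (lam Lam : ℕ) (C : ℝ) (σ : ℝ≥0) (η : ℝ)
    (θ₀ : Param D) (x : Dataset N L) : Measure (Fin (N * lam / Lam) → Param D) :=
  stepsLaw m lam Lam C σ η x (N * lam / Lam) 0 θ₀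

/-- The per-epoch privacy profile `H(α) = sup H_α(M_x‖M_x')` over all `1`-event-level neighbouring
datasets of `N` series of length `L`. -/
def privacyProfile (N L : ℕ) {D LC LF : ℕ} (m : ForecastModel D LC LF) (lam Lam : ℕ) (C : ℝ)
    (σ : ℝ≥0) (η : ℝ) (θ₀ : Param D) (α : ℝ≥0) : ℝ≥0∞ :=
  ⨆ (x : Dataset N L) (x' : Dataset N L) (_ : EventNeighbor 1 x x'),
    hockeyStick α (epochLaw m lam Lam C σ η θ₀ x) (epochLaw m lam Lam C σ η θ₀ x')

/-- The mixture `P(1)`: means `(0, 2)`, weights `(1 - r, r)`, standard deviation `σ`, where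
`r = (LC + LF) / (L - LF + 1)`. -/
def mixtureP (L LC LF : ℕ) (σ : ℝ≥0) : Measure ℝ :=
  MoG ![0, 2]
    ![1 - ((LC : ℝ) + LF) / ((L : ℝ) - LF + 1), ((LC : ℝ) + LF) / ((L : ℝ) - LF + 1)] σ

/-- The claimed profile: `H_α(P(1)‖N(0, σ))` for `α ≥ 1` and `H_α(N(0, σ)‖P(1))` for `α < 1`. -/
def tightProfile (L LC LF : ℕ) (σ : ℝ≥0) (α : ℝ≥0) : ℝ≥0∞ :=
  if 1 ≤ α then hockeyStick α (mixtureP L LC LF σ) (gaussianReal 0 (σ ^ 2))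
  else hockeyStick α (gaussianReal 0 (σ ^ 2)) (mixtureP L LC LF σ)

end DPForecast

end

open DPForecast

/-! For P ≪ Q, H_α(P‖Q) ≤ h means exactly that ∫φ dP ≤ α ∫φ dQ + h for every test 0 ≤ φ ≤ 1
(`hockeyStick_le`, `lintegral_le_hockeyStick`). In this form data processing, mixing and composition
are manipulations of linear inequalities.

Upper bound. The changed series lies in at most one batch, so only one step distinguishes the
datasets; the steps before and after have equal conditional laws and cost nothing
(`lintegral_stepsLaw_le`). In that step, fix the start indices of all other series. What remains are
two uniform mixtures of spherical Gaussians, indexed by the start index of the changed series.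
Clipping puts any two of their means at distance at most 2C, and the means agree outside a set of
proportion r of the indices. Any two such Gaussians are the image of N(0, σ), N(2, σ) under one
kernel (`exists_lintegral_gaussianReal_eq`), so each pair of components inherits the test inequality
that defines the tight profile. Averaging these inequalities over all pairs, with weights depending
on α (`sum_le_of_one_le`, `sum_le_of_lt_one`), gives the bound for the mixtures.

Lower bound. A model linear in θ has gradient C e if the window contains a marker value and -C e
otherwise. With one marker placed where exactly LC + LF start indices reach it, a statistic of the
first released gradient has law P(1) on one dataset and N(0, σ) on its neighbour
(`tightProfile_le_privacyProfile`). The model does not depend on α; only the order of the two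
datasets does. -/

namespace DPForecast

/-! ### Hockey-stick divergence through tests -/

section HockeyStick

variable {Ω : Type*} [MeasurableSpace Ω]

/-- The divergence is attained on the set where the density exceeds α. Absolute continuity is not
needed: the density integrates to at most P on any set. -/
lemma hockeyStick_le {P Q : Measure Ω} [IsFiniteMeasure Q] {α : ℝ≥0} {h : ℝ≥0∞}
    (H : ∀ s, MeasurableSet s → P s ≤ α * Q s + h) : hockeyStick α P Q ≤ h := by
  set A : Set Ω := {o | (α : ℝ≥0∞) < P.rnDeriv Q o} with hA
  have hAm : MeasurableSet A := measurableSet_lt measurable_const (P.measurable_rnDeriv Q)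
  have h1 : hockeyStick α P Q = ∫⁻ o in A, (P.rnDeriv Q o - α) ∂Q := by
    rw [hockeyStick, ← lintegral_indicator hAm]
    refine lintegral_congr fun o => ?_
    by_cases ho : o ∈ A
    · simp [ho]
    · rw [Set.indicator_of_notMem ho]
      exact tsub_eq_zero_of_le (not_lt.1 ho)
  have h2 : hockeyStick α P Q + α * Q A ≤ h + α * Q A := by
    rw [h1, ← setLIntegral_const, ← lintegral_add_right _ measurable_const, setLIntegral_const]
    calc ∫⁻ o in A, (P.rnDeriv Q o - α + α) ∂Q
        = ∫⁻ o in A, P.rnDeriv Q o ∂Q :=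
          setLIntegral_congr_fun hAm fun o ho => tsub_add_cancel_of_le (le_of_lt ho)
      _ ≤ P A := Measure.setLIntegral_rnDeriv_le A
      _ ≤ h + α * Q A := by rw [add_comm]; exact H A hAm
  exact (ENNReal.add_le_add_iff_right
    (ENNReal.mul_ne_top ENNReal.coe_ne_top (measure_ne_top Q A))).1 h2

/-- Pointwise dP/dQ ≤ α + (dP/dQ - α)⁺; multiply by φ ≤ 1 and integrate against Q. -/
lemma lintegral_le_hockeyStick {P Q : Measure Ω} [SigmaFinite P] [SigmaFinite Q] (hPQ : P ≪ Q)
    (α : ℝ≥0) {φ : Ω → ℝ≥0∞} (hφ : Measurable φ) (hφ1 : ∀ o, φ o ≤ 1) :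
    ∫⁻ o, φ o ∂P ≤ α * ∫⁻ o, φ o ∂Q + hockeyStick α P Q := by
  rw [← lintegral_rnDeriv_mul hPQ hφ.aemeasurable, hockeyStick, ← lintegral_const_mul _ hφ,
    ← lintegral_add_left (hφ.const_mul _)]
  refine lintegral_mono fun o => ?_
  calc P.rnDeriv Q o * φ o ≤ (α + (P.rnDeriv Q o - α)) * φ o := by
        gcongr; exact le_add_tsub
    _ = α * φ o + (P.rnDeriv Q o - α) * φ o := add_mul _ _ _
    _ ≤ α * φ o + (P.rnDeriv Q o - α) * 1 := by gcongr; exact hφ1 o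
    _ = _ := by rw [mul_one]

lemma hockeyStick_ne_top {P Q : Measure Ω} [IsFiniteMeasure P] (α : ℝ≥0) :
    hockeyStick α P Q ≠ ∞ := by
  refine ne_top_of_le_ne_top (measure_ne_top P Set.univ) ?_
  exact (lintegral_mono fun o => tsub_le_self).trans Measure.lintegral_rnDeriv_le

end HockeyStick

/-! ### Reduction of spherical Gaussians to one dimension -/

section Gaussian

variable {D : ℕ}

open Complex in
/-- A spherical Gaussian splits into independent components along a short vector `u` and a
remainder. -/
lemma map_prod_gaussianReal_stdGaussian {C : ℝ} (hC : 0 < C) (σ : ℝ≥0) {u : Param D}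
    (hu : ‖u‖ ≤ C) : ∃ S : Param D →L[ℝ] Param D, ∀ (a : ℝ) (v : Param D),
    ((gaussianReal a (σ ^ 2)).prod (stdGaussian (Param D))).map
        (fun p => v + p.1 • u + (σ : ℝ) • S p.2) =
      (stdGaussian (Param D)).map fun z => v + a • u + ((σ : ℝ) * C) • z := by
  have hCu : 0 ≤ C ^ 2 - ‖u‖ ^ 2 := by nlinarith [norm_nonneg u]
  set q := √(C ^ 2 - ‖u‖ ^ 2) with hq
  have hq2 : q ^ 2 = C ^ 2 - ‖u‖ ^ 2 := Real.sq_sqrt hCu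
  have hq0 : 0 ≤ q := Real.sqrt_nonneg _
  -- `S` is to be the symmetric square root of C² I - u uᵀ, so that adding the noise along `u`
  -- restores covariance σ²C² I. With `S` = C I - c u uᵀ this requires c (2C - c ‖u‖²) = 1, which
  -- this `c` solves because ‖u‖² = (C + q)(C - q).
  set c := (C + q)⁻¹ with hc
  have hcq : c * (C + q) = 1 := inv_mul_cancel₀ (by positivity)
  let S : Param D →L[ℝ] Param D :=
    C • ContinuousLinearMap.id ℝ _ - c • (innerSL ℝ u).smulRight u
  have hS : ∀ z, S z = C • z - (c * inner ℝ u z) • u := fun z => by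
    simp [S, smul_smul]
  have hSsymm : ∀ z t, inner ℝ (S z) t = inner ℝ z (S t) := fun z t => by
    rw [hS, hS, inner_sub_left, inner_sub_right, real_inner_smul_left, real_inner_smul_left,
      real_inner_smul_right, real_inner_smul_right, real_inner_comm z u]
    ring
  have hSnorm : ∀ t, ‖S t‖ ^ 2 + (inner ℝ u t) ^ 2 = C ^ 2 * ‖t‖ ^ 2 := fun t => by
    rw [hS, norm_sub_sq_real, norm_smul, norm_smul, real_inner_smul_left, real_inner_smul_right,
      real_inner_comm u t, mul_pow, mul_pow, Real.norm_eq_abs, Real.norm_eq_abs, sq_abs, sq_abs]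
    have h1 : c * ‖u‖ ^ 2 = C - q := by
      have : ‖u‖ ^ 2 = (C + q) * (C - q) := by nlinarith
      rw [this, ← mul_assoc, hcq, one_mul]
    have h2 : c * (2 * C - c * ‖u‖ ^ 2) = 1 := by rw [h1]; linarith
    linear_combination (- (inner ℝ u t) ^ 2) * h2
  refine ⟨S, fun a v => ?_⟩
  have hm1 : Measurable fun p : ℝ × Param D => v + p.1 • u + (σ : ℝ) • S p.2 := by fun_prop
  have hm2 : Measurable fun z : Param D => v + a • u + ((σ : ℝ) * C) • z := by fun_prop
  have := Measure.isProbabilityMeasure_map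
    (μ := (gaussianReal a (σ ^ 2)).prod (stdGaussian (Param D))) hm1.aemeasurable
  have := Measure.isProbabilityMeasure_map (μ := stdGaussian (Param D)) hm2.aemeasurable
  -- The characteristic function of the product factorizes; the quadratic exponents agree by
  -- `hSnorm`.
  refine Measure.ext_of_charFun (funext fun t => ?_)
  rw [charFun_apply, charFun_apply, integral_map hm1.aemeasurable (by fun_prop),
    integral_map hm2.aemeasurable (by fun_prop)]
  have e1 : ∀ p : ℝ × Param D, cexp (inner ℝ (v + p.1 • u + (σ : ℝ) • S p.2) t * I) =
      cexp (inner ℝ v t * I) * (cexp (inner ℝ u t * p.1 * I) *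
        cexp (inner ℝ p.2 ((σ : ℝ) • S t) * I)) := fun p => by
    rw [← Complex.exp_add, ← Complex.exp_add, inner_add_left, inner_add_left,
      real_inner_smul_left, real_inner_smul_left, real_inner_smul_right, hSsymm]
    push_cast; ring_nf
  have e2 : ∀ z : Param D, cexp (inner ℝ (v + a • u + ((σ : ℝ) * C) • z) t * I) =
      cexp (inner ℝ (v + a • u) t * I) * cexp (inner ℝ z (((σ : ℝ) * C) • t) * I) := fun z => by
    rw [← Complex.exp_add, inner_add_left (v + a • u), real_inner_smul_left,
      real_inner_smul_right]
    push_cast; ring_nf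
  simp_rw [e1, e2]
  rw [integral_const_mul, integral_const_mul,
    integral_prod_mul (fun y : ℝ => cexp (inner ℝ u t * y * I))
      (fun z : Param D => cexp (inner ℝ z ((σ : ℝ) • S t) * I)),
    ← charFun_apply_real, ← charFun_apply, ← charFun_apply, charFun_gaussianReal,
    charFun_stdGaussian, charFun_stdGaussian, ← Complex.exp_add, ← Complex.exp_add,
    ← Complex.exp_add, inner_add_left, real_inner_smul_left]
  congr 1
  have h3 := congrArg ((↑) : ℝ → ℂ) (hSnorm t)
  rw [norm_smul, norm_smul, Real.norm_of_nonneg σ.coe_nonneg,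
    Real.norm_of_nonneg (by positivity)]
  push_cast at h3 ⊢
  linear_combination (- (σ : ℂ) ^ 2 / 2) * h3

/-- Two spherical Gaussians at distance at most `2 C` are obtained from `N(0, σ)` and `N(2, σ)` by
one Markov kernel. -/
lemma exists_lintegral_gaussianReal_eq {C : ℝ} (hC : 0 < C) (σ : ℝ≥0) {v w : Param D}
    (hvw : ‖v - w‖ ≤ 2 * C) {φ : Param D → ℝ≥0∞} (hφ : Measurable φ) (hφ1 : ∀ o, φ o ≤ 1) :
    ∃ ψ : ℝ → ℝ≥0∞, Measurable ψ ∧ (∀ y, ψ y ≤ 1) ∧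
      ∫⁻ z, φ (v + ((σ : ℝ) * C) • z) ∂stdGaussian (Param D) =
        ∫⁻ y, ψ y ∂gaussianReal 0 (σ ^ 2) ∧
      ∫⁻ z, φ (w + ((σ : ℝ) * C) • z) ∂stdGaussian (Param D) =
        ∫⁻ y, ψ y ∂gaussianReal 2 (σ ^ 2) := by
  -- With u = (w - v)/2, the scalar means 0 and 2 become v and w, and the remaining noise is the
  -- same for both. Integrating that noise out of φ gives ψ.
  have hu : ‖(1 / 2 : ℝ) • (w - v)‖ ≤ C := by
    rw [norm_smul, norm_sub_rev, Real.norm_of_nonneg (by norm_num)]; linarith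
  obtain ⟨S, hS⟩ := map_prod_gaussianReal_stdGaussian hC σ hu
  set u := (1 / 2 : ℝ) • (w - v) with hu'
  have hF : Measurable fun p : ℝ × Param D => φ (v + p.1 • u + (σ : ℝ) • S p.2) :=
    hφ.comp (by fun_prop)
  have key : ∀ a : ℝ, ∫⁻ z, φ (v + a • u + ((σ : ℝ) * C) • z) ∂stdGaussian (Param D) =
      ∫⁻ y, ∫⁻ z, φ (v + y • u + (σ : ℝ) • S z) ∂stdGaussian (Param D)
        ∂gaussianReal a (σ ^ 2) := fun a => by
    have h := congrArg (fun μ => ∫⁻ o, φ o ∂μ) (hS a v)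
    simp only at h
    rw [lintegral_map hφ (by fun_prop), lintegral_map hφ (by fun_prop)] at h
    rw [← h, lintegral_prod _ hF.aemeasurable]
  refine ⟨fun y => ∫⁻ z, φ (v + y • u + (σ : ℝ) • S z) ∂stdGaussian (Param D),
    hF.lintegral_prod_right', fun y => ?_, ?_, ?_⟩
  · exact (lintegral_mono fun z => hφ1 _).trans (by simp)
  · rw [← key]; simp
  · rw [← key]
    have : v + (2 : ℝ) • u = w := by
      rw [hu', smul_smul]; norm_num
    rw [this]

end Gaussian

/-! ### The mixture P(1) and the tight profile -/

section Mixture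

lemma lintegral_mixtureP (L LC LF : ℕ) (σ : ℝ≥0) (ψ : ℝ → ℝ≥0∞) :
    ∫⁻ y, ψ y ∂mixtureP L LC LF σ =
      ENNReal.ofReal (1 - ((LC : ℝ) + LF) / ((L : ℝ) - LF + 1)) *
          ∫⁻ y, ψ y ∂gaussianReal 0 (σ ^ 2) +
        ENNReal.ofReal (((LC : ℝ) + LF) / ((L : ℝ) - LF + 1)) *
          ∫⁻ y, ψ y ∂gaussianReal 2 (σ ^ 2) := by
  simp [mixtureP, MoG, lintegral_add_measure, lintegral_smul_measure]

/-- The fraction of subsequences that can contain a given element. -/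
lemma ratio_mem_Ioc {L LC LF : ℕ} (hLF : 0 < LF) (hL : LC + LF + LF ≤ L + 1) :
    ((LC : ℝ) + LF) / ((L : ℝ) - LF + 1) ∈ Set.Ioc (0 : ℝ) 1 := by
  have h1 : (0 : ℝ) < LF := by exact_mod_cast hLF
  have h2 : (LC : ℝ) + LF + LF ≤ L + 1 := by exact_mod_cast hL
  have h3 : (0 : ℝ) ≤ LC := by positivity
  refine ⟨div_pos (by linarith) (by linarith), (div_le_one (by linarith)).2 (by linarith)⟩

lemma isProbabilityMeasure_mixtureP {L LC LF : ℕ} (σ : ℝ≥0) (hLF : 0 < LF)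
    (hL : LC + LF + LF ≤ L + 1) : IsProbabilityMeasure (mixtureP L LC LF σ) := by
  have hr := ratio_mem_Ioc hLF hL
  refine ⟨?_⟩
  rw [← lintegral_one, lintegral_mixtureP, lintegral_one, lintegral_one, measure_univ,
    measure_univ, mul_one, mul_one, ← ENNReal.ofReal_add (by linarith [hr.2]) hr.1.le]
  simp

lemma mixtureP_absolutelyContinuous {L LC LF : ℕ} {σ : ℝ≥0} (hσ : 0 < σ) :
    mixtureP L LC LF σ ≪ gaussianReal 0 (σ ^ 2) := by
  have hv : σ ^ 2 ≠ 0 := by positivity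
  refine Measure.AbsolutelyContinuous.mk fun s hs h0 => ?_
  have h2 : gaussianReal 2 (σ ^ 2) s = 0 :=
    gaussianReal_absolutelyContinuous 2 hv (gaussianReal_absolutelyContinuous' 0 hv h0)
  rw [← lintegral_indicator_one hs, lintegral_mixtureP, lintegral_indicator_one hs,
    lintegral_indicator_one hs, h0, h2]
  simp

lemma gaussianReal_absolutelyContinuous_mixtureP {L LC LF : ℕ} {σ : ℝ≥0} (hσ : 0 < σ)
    (hLF : 0 < LF) (hL : LC + LF + LF ≤ L + 1) :
    gaussianReal 0 (σ ^ 2) ≪ mixtureP L LC LF σ := by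
  have hv : σ ^ 2 ≠ 0 := by positivity
  refine Measure.AbsolutelyContinuous.mk fun s hs h0 => ?_
  rw [← lintegral_indicator_one hs, lintegral_mixtureP, lintegral_indicator_one hs,
    lintegral_indicator_one hs, add_eq_zero, mul_eq_zero, mul_eq_zero] at h0
  have h2 : gaussianReal 2 (σ ^ 2) s = 0 := h0.2.resolve_left
    (ENNReal.ofReal_pos.2 (ratio_mem_Ioc hLF hL).1).ne'
  exact gaussianReal_absolutelyContinuous 0 hv (gaussianReal_absolutelyContinuous' 2 hv h2)

lemma tightProfile_of_one_le {L LC LF : ℕ} {σ α : ℝ≥0} (hα : 1 ≤ α) :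
    tightProfile L LC LF σ α =
      hockeyStick α (mixtureP L LC LF σ) (gaussianReal 0 (σ ^ 2)) := if_pos hα

lemma tightProfile_of_not_one_le {L LC LF : ℕ} {σ α : ℝ≥0} (hα : ¬ 1 ≤ α) :
    tightProfile L LC LF σ α =
      hockeyStick α (gaussianReal 0 (σ ^ 2)) (mixtureP L LC LF σ) := if_neg hα

lemma tightProfile_ne_top {L LC LF : ℕ} {σ : ℝ≥0} (hLF : 0 < LF)
    (hL : LC + LF + LF ≤ L + 1) (α : ℝ≥0) : tightProfile L LC LF σ α ≠ ∞ := by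
  have := isProbabilityMeasure_mixtureP σ hLF hL
  unfold tightProfile
  split_ifs <;> exact hockeyStick_ne_top α

/-- For α < 1 this is the test inequality for φ = 1. It serves as the zero-step case of the
induction over the epoch. -/
lemma one_le_add_tightProfile {L LC LF : ℕ} {σ : ℝ≥0} (hσ : 0 < σ) (hLF : 0 < LF)
    (hL : LC + LF + LF ≤ L + 1) (α : ℝ≥0) : 1 ≤ α + tightProfile L LC LF σ α := by
  have := isProbabilityMeasure_mixtureP σ hLF hL
  unfold tightProfile
  split_ifs with hα
  · exact le_add_right (by exact_mod_cast hα)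
  · simpa using lintegral_le_hockeyStick
      (gaussianReal_absolutelyContinuous_mixtureP hσ hLF hL) α
      (φ := fun _ => 1) measurable_const (fun _ => le_rfl)

/-- The test inequality for (P(1), N(0, σ)) with the N(0, σ) part of the mixture moved to the right.
This isolates a single pair of components, the form that `sum_le_of_one_le` averages. -/
lemma toReal_lintegral_le_of_one_le {L LC LF : ℕ} {σ : ℝ≥0} (hσ : 0 < σ) (hLF : 0 < LF)
    (hL : LC + LF + LF ≤ L + 1) {α : ℝ≥0} (hα : 1 ≤ α) {ψ : ℝ → ℝ≥0∞} (hψ : Measurable ψ)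
    (hψ1 : ∀ y, ψ y ≤ 1) :
    ((LC : ℝ) + LF) / ((L : ℝ) - LF + 1) * (∫⁻ y, ψ y ∂gaussianReal 2 (σ ^ 2)).toReal ≤
      (α - 1 + ((LC : ℝ) + LF) / ((L : ℝ) - LF + 1)) *
          (∫⁻ y, ψ y ∂gaussianReal 0 (σ ^ 2)).toReal +
        (tightProfile L LC LF σ α).toReal := by
  have := isProbabilityMeasure_mixtureP σ hLF hL
  have hfin : ∀ a, ∫⁻ y, ψ y ∂gaussianReal a (σ ^ 2) ≠ ∞ := fun a =>
    ne_top_of_le_ne_top ENNReal.one_ne_top ((lintegral_mono hψ1).trans (by simp))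
  have hr := ratio_mem_Ioc hLF hL
  have ht := tightProfile_ne_top (σ := σ) hLF hL α
  have h := lintegral_le_hockeyStick (mixtureP_absolutelyContinuous hσ (L := L) (LC := LC)
    (LF := LF)) α hψ hψ1
  rw [← tightProfile_of_one_le hα, lintegral_mixtureP] at h
  generalize ((LC : ℝ) + LF) / ((L : ℝ) - LF + 1) = r at *
  generalize tightProfile L LC LF σ α = H at *
  have h0 := hfin 0
  have h2 := hfin 2
  generalize ∫⁻ y, ψ y ∂gaussianReal 0 (σ ^ 2) = x at *
  generalize ∫⁻ y, ψ y ∂gaussianReal 2 (σ ^ 2) = y at *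
  lift x to ℝ≥0 using h0
  lift y to ℝ≥0 using h2
  lift H to ℝ≥0 using ht
  have h3 := ENNReal.toReal_mono (by finiteness) h
  rw [ENNReal.toReal_add (by finiteness) (by finiteness), ENNReal.toReal_add (by finiteness)
    (by finiteness)] at h3
  simp only [ENNReal.toReal_mul, ENNReal.coe_toReal, ENNReal.toReal_ofReal hr.1.le,
    ENNReal.toReal_ofReal (sub_nonneg.2 hr.2)] at h3 ⊢
  linarith

/-- The analogue for the pair (N(0, σ), P(1)), with the N(0, σ) part of the mixture moved to the
left, as `sum_le_of_lt_one` needs it. -/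
lemma toReal_lintegral_le_of_lt_one {L LC LF : ℕ} {σ : ℝ≥0} (hσ : 0 < σ) (hLF : 0 < LF)
    (hL : LC + LF + LF ≤ L + 1) {α : ℝ≥0} (hα : ¬ 1 ≤ α) {ψ : ℝ → ℝ≥0∞} (hψ : Measurable ψ)
    (hψ1 : ∀ y, ψ y ≤ 1) :
    (1 - α + α * (((LC : ℝ) + LF) / ((L : ℝ) - LF + 1))) *
        (∫⁻ y, ψ y ∂gaussianReal 0 (σ ^ 2)).toReal ≤
      α * (((LC : ℝ) + LF) / ((L : ℝ) - LF + 1)) *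
          (∫⁻ y, ψ y ∂gaussianReal 2 (σ ^ 2)).toReal +
        (tightProfile L LC LF σ α).toReal := by
  have := isProbabilityMeasure_mixtureP σ hLF hL
  have hfin : ∀ a, ∫⁻ y, ψ y ∂gaussianReal a (σ ^ 2) ≠ ∞ := fun a =>
    ne_top_of_le_ne_top ENNReal.one_ne_top ((lintegral_mono hψ1).trans (by simp))
  have hr := ratio_mem_Ioc hLF hL
  have ht := tightProfile_ne_top (σ := σ) hLF hL α
  have h := lintegral_le_hockeyStick (gaussianReal_absolutelyContinuous_mixtureP hσ hLF hL)
    α hψ hψ1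
  rw [← tightProfile_of_not_one_le hα, lintegral_mixtureP] at h
  generalize ((LC : ℝ) + LF) / ((L : ℝ) - LF + 1) = r at *
  generalize tightProfile L LC LF σ α = H at *
  have h0 := hfin 0
  have h2 := hfin 2
  generalize ∫⁻ y, ψ y ∂gaussianReal 0 (σ ^ 2) = x at *
  generalize ∫⁻ y, ψ y ∂gaussianReal 2 (σ ^ 2) = y at *
  lift x to ℝ≥0 using h0
  lift y to ℝ≥0 using h2
  lift H to ℝ≥0 using ht
  have h3 := ENNReal.toReal_mono (by finiteness) h
  rw [ENNReal.toReal_add (by finiteness) (by finiteness), ENNReal.toReal_mul,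
    ENNReal.toReal_add (by finiteness) (by finiteness)] at h3
  simp only [ENNReal.toReal_mul, ENNReal.coe_toReal, ENNReal.toReal_ofReal hr.1.le,
    ENNReal.toReal_ofReal (sub_nonneg.2 hr.2)] at h3 ⊢
  linarith

end Mixture

/-! ### Advanced joint convexity for finite families -/

section Averaging

variable {Y : Type*} [Fintype Y]

lemma le_weighted_sum_add {w x : Y → ℝ} {W c h : ℝ} (hw : ∀ u, 0 ≤ w u) (hW : ∑ u, w u = W)
    (hW0 : 0 < W) (H : ∀ u, c ≤ W * x u + h) : c ≤ ∑ u, w u * x u + h := by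
  have h1 : ∑ u, w u * c ≤ ∑ u, w u * (W * x u + h) :=
    Finset.sum_le_sum fun u _ => mul_le_mul_of_nonneg_left (H u) (hw u)
  have h2 : ∑ u, w u * (W * x u + h) = W * (∑ u, w u * x u + h) := by
    rw [mul_add, Finset.mul_sum]
    nth_rw 3 [← hW]
    rw [Finset.sum_mul, ← Finset.sum_add_distrib]
    exact Finset.sum_congr rfl fun u _ => by ring
  rw [← Finset.sum_mul, hW, h2] at h1
  exact le_of_mul_le_mul_left h1 hW0

variable [DecidableEq Y]

/-- Advanced joint convexity for `α ≥ 1`, in terms of the two families of probabilities. -/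
lemma sum_le_of_one_le {S : Finset Y} {p q : Y → ℝ} {α r h : ℝ} (hα : 1 ≤ α) (hr : 0 < r)
    (hS : (S.card : ℝ) = r * Fintype.card Y) (hpq : ∀ t, t ∉ S → p t = q t)
    (H : ∀ t ∈ S, ∀ u, r * p t ≤ (α - 1 + r) * q u + h) :
    ∑ t, p t ≤ α * ∑ t, q t + Fintype.card Y * h := by
  rcases isEmpty_or_nonempty Y with hY | hY
  · simp
  have hT : (0 : ℝ) < Fintype.card Y := by exact_mod_cast Fintype.card_pos
  set T : ℝ := (Fintype.card Y : ℝ) with hT'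
  have hs : (0 : ℝ) < S.card := by rw [hS]; positivity
  have hind : ∀ f : Y → ℝ, ∑ u, (if u ∈ S then f u else 0) = ∑ u ∈ S, f u := fun f => by
    rw [← Finset.sum_filter]; simp
  have hq : ∑ t, q t = ∑ t ∈ S, q t + ∑ t ∈ Sᶜ, q t := (Finset.sum_add_sum_compl S q).symm
  have hp : ∑ t, p t = ∑ t ∈ S, p t + ∑ t ∈ Sᶜ, q t := by
    rw [← Finset.sum_add_sum_compl S p]
    congr 1
    exact Finset.sum_congr rfl fun t ht => hpq t (Finset.mem_compl.1 ht)
  have key : ∀ t ∈ S, S.card * p t ≤ (α - 1) * ∑ u, q u + ∑ u ∈ S, q u + T * h := by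
    intro t ht
    -- Mass α - 1 is spread over all indices and mass r over `S`. The first part reproduces the
    -- extra (α - 1) ∑ q, the second compares the affected components with each other.
    have hW : ∑ u : Y, ((α - 1) / T + if u ∈ S then 1 / T else 0) = α - 1 + r := by
      rw [Finset.sum_add_distrib, hind, Finset.sum_const, Finset.sum_const, nsmul_eq_mul,
        nsmul_eq_mul, hS, Finset.card_univ]
      rw [← hT']
      field_simp
    have h1 := le_weighted_sum_add (x := q) (fun u => by
      have : 0 ≤ (α - 1) / T := div_nonneg (by linarith) hT.le
      split_ifs <;> positivity) hW (by linarith) (H t ht)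
    simp only [add_mul, ite_mul, zero_mul, Finset.sum_add_distrib, hind, ← Finset.mul_sum] at h1
    rw [hS]
    calc r * T * p t = T * (r * p t) := by ring
      _ ≤ T * ((α - 1) / T * ∑ u, q u + 1 / T * ∑ u ∈ S, q u + h) := by gcongr
      _ = _ := by field_simp
  have h2 := Finset.sum_le_sum key
  rw [← Finset.mul_sum, Finset.sum_const, nsmul_eq_mul] at h2
  have h3 := le_of_mul_le_mul_left h2 hs
  rw [hp]
  linarith

/-- Advanced joint convexity for `α < 1`, in terms of the two families of probabilities. -/
lemma sum_le_of_lt_one {S : Finset Y} {p q : Y → ℝ} {α r h : ℝ} (hα0 : 0 ≤ α) (hα : α < 1)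
    (hr : 0 < r) (hS : (S.card : ℝ) = r * Fintype.card Y) (hpq : ∀ t, t ∉ S → p t = q t)
    (H : ∀ u ∈ S, ∀ t, (1 - α + α * r) * p t ≤ α * r * q u + h) :
    ∑ t, p t ≤ α * ∑ t, q t + Fintype.card Y * h := by
  rcases isEmpty_or_nonempty Y with hY | hY
  · simp
  have hT : (0 : ℝ) < Fintype.card Y := by exact_mod_cast Fintype.card_pos
  set T : ℝ := (Fintype.card Y : ℝ) with hT'
  have hs : (0 : ℝ) < S.card := by rw [hS]; positivity
  have hind : ∀ f : Y → ℝ, ∑ u, (if u ∈ S then f u else 0) = ∑ u ∈ S, f u := fun f => by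
    rw [← Finset.sum_filter]; simp
  have hq : ∑ t, q t = ∑ t ∈ S, q t + ∑ t ∈ Sᶜ, p t := by
    rw [← Finset.sum_add_sum_compl S q]
    congr 1
    exact Finset.sum_congr rfl fun t ht => (hpq t (Finset.mem_compl.1 ht)).symm
  have hp : ∑ t, p t = ∑ t ∈ S, p t + ∑ t ∈ Sᶜ, p t := (Finset.sum_add_sum_compl S p).symm
  have key : ∀ u ∈ S, (1 - α) * ∑ t, p t + α * ∑ t ∈ S, p t ≤ S.card * (α * q u) + T * h := by
    intro u hu
    -- Now `q u` is fixed and p is averaged: mass 1 - α over all indices and α r over `S`.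
    have hW : ∑ t : Y, ((1 - α) / T + if t ∈ S then α / T else 0) = 1 - α + α * r := by
      rw [Finset.sum_add_distrib, hind, Finset.sum_const, Finset.sum_const, nsmul_eq_mul,
        nsmul_eq_mul, hS, Finset.card_univ]
      rw [← hT']
      field_simp
    -- The averaged quantity stands on the smaller side here, hence the signs.
    have h1 := le_weighted_sum_add (x := fun t => - p t) (c := - (α * r * q u)) (h := h)
      (fun u => by
        have : 0 ≤ (1 - α) / T := div_nonneg (by linarith) hT.le
        split_ifs <;> positivity) hW (by have := mul_nonneg hα0 hr.le; linarith)
      (fun t => by have := H u hu t; linarith)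
    simp only [add_mul, ite_mul, zero_mul, Finset.sum_add_distrib, hind, ← Finset.mul_sum,
      Finset.sum_neg_distrib] at h1
    rw [hS]
    have h4 : (1 - α) / T * ∑ t, p t + α / T * ∑ t ∈ S, p t ≤ α * r * q u + h := by linarith
    calc (1 - α) * ∑ t, p t + α * ∑ t ∈ S, p t
        = T * ((1 - α) / T * ∑ t, p t + α / T * ∑ t ∈ S, p t) := by field_simp
      _ ≤ T * (α * r * q u + h) := by gcongr
      _ = _ := by ring
  have h2 := Finset.sum_le_sum key
  rw [Finset.sum_const, nsmul_eq_mul, Finset.sum_add_distrib, ← Finset.mul_sum, ← Finset.mul_sum,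
    Finset.sum_const, nsmul_eq_mul, ← mul_add] at h2
  have h3 := le_of_mul_le_mul_left h2 hs
  rw [hp] at h3 ⊢
  rw [hq]
  linarith

end Averaging

/-! ### Uniform Gaussian mixtures and resampling one coordinate -/

section Families

variable {D : ℕ} {Y : Type*} [Fintype Y] [DecidableEq Y]

/-- The divergence bound for two uniform mixtures of spherical Gaussians that share the components
outside `S`. -/
lemma sum_lintegral_le {L LC LF : ℕ} {σ : ℝ≥0} (hσ : 0 < σ) (hLF : 0 < LF)
    (hL : LC + LF + LF ≤ L + 1) {C : ℝ} (hC : 0 < C) {S : Finset Y} {v w : Y → Param D}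
    (hS : (S.card : ℝ) = ((LC : ℝ) + LF) / ((L : ℝ) - LF + 1) * Fintype.card Y)
    (hvw : ∀ t u, ‖v t - w u‖ ≤ 2 * C) (heq : ∀ t, t ∉ S → v t = w t) (α : ℝ≥0)
    {φ : Param D → ℝ≥0∞} (hφ : Measurable φ) (hφ1 : ∀ o, φ o ≤ 1) :
    ∑ t, ∫⁻ z, φ (v t + ((σ : ℝ) * C) • z) ∂stdGaussian (Param D) ≤
      α * ∑ t, ∫⁻ z, φ (w t + ((σ : ℝ) * C) • z) ∂stdGaussian (Param D) +
        Fintype.card Y * tightProfile L LC LF σ α := by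
  have hfin : ∀ a : Param D, ∫⁻ z, φ (a + ((σ : ℝ) * C) • z) ∂stdGaussian (Param D) ≠ ∞ :=
    fun a => ne_top_of_le_ne_top ENNReal.one_ne_top
      ((lintegral_mono fun z => hφ1 _).trans (by simp))
  have ht := tightProfile_ne_top (σ := σ) hLF hL α
  have hr := ratio_mem_Ioc hLF hL
  have hwv : ∀ t u, ‖w u - v t‖ ≤ 2 * C := fun t u => by rw [norm_sub_rev]; exact hvw t u
  have key : ∑ t, (∫⁻ z, φ (v t + ((σ : ℝ) * C) • z) ∂stdGaussian (Param D)).toReal ≤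
      α * ∑ t, (∫⁻ z, φ (w t + ((σ : ℝ) * C) • z) ∂stdGaussian (Param D)).toReal +
        Fintype.card Y * (tightProfile L LC LF σ α).toReal := by
    by_cases hα : 1 ≤ α
    · refine sum_le_of_one_le (by exact_mod_cast hα) hr.1 hS (fun t h => by rw [heq t h])
        fun t _ u => ?_
      -- For α ≥ 1 the component of the second mixture plays N(0, σ) and that of the first plays
      -- N(2, σ); for α < 1 the roles are exchanged.
      obtain ⟨ψ, hψ, hψ1, h0, h2⟩ := exists_lintegral_gaussianReal_eq hC σ (hwv t u) hφ hφ1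
      rw [h0, h2]
      exact toReal_lintegral_le_of_one_le hσ hLF hL hα hψ hψ1
    · refine sum_le_of_lt_one α.coe_nonneg (by exact_mod_cast not_le.1 hα) hr.1 hS
        (fun t h => by rw [heq t h]) fun u _ t => ?_
      obtain ⟨ψ, hψ, hψ1, h0, h2⟩ := exists_lintegral_gaussianReal_eq hC σ (hvw t u) hφ hφ1
      rw [h0, h2]
      exact toReal_lintegral_le_of_lt_one hσ hLF hL hα hψ hψ1
  have hs : ∀ f : Y → Param D,
      ∑ t, ∫⁻ z, φ (f t + ((σ : ℝ) * C) • z) ∂stdGaussian (Param D) ≠ ∞ := fun f =>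
    ENNReal.sum_ne_top.2 fun t _ => hfin _
  have hs1 := hs v
  have hs2 := hs w
  rw [← ENNReal.toReal_sum fun t _ => hfin _, ← ENNReal.toReal_sum fun t _ => hfin _] at key
  generalize ∑ t, ∫⁻ z, φ (v t + ((σ : ℝ) * C) • z) ∂stdGaussian (Param D) = a at *
  generalize ∑ t, ∫⁻ z, φ (w t + ((σ : ℝ) * C) • z) ∂stdGaussian (Param D) = b at *
  generalize tightProfile L LC LF σ α = h at *
  lift a to ℝ≥0 using hs1
  lift b to ℝ≥0 using hs2
  lift h to ℝ≥0 using ht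
  simp only [ENNReal.coe_toReal] at key
  exact_mod_cast key

end Families

/-- Resampling one coordinate does not change a sum over all functions. -/
lemma sum_sum_update {ι Y : Type*} [Fintype ι] [DecidableEq ι] [Fintype Y] (i : ι) (F : (ι → Y) → ℝ≥0∞) :
    ∑ τ : ι → Y, ∑ t : Y, F (Function.update τ i t) = Fintype.card Y * ∑ τ, F τ := by
  -- Exchanging the fresh value with the old coordinate is a bijection on pairs (τ, t), after which
  -- the summand no longer depends on the fresh value.
  have hinv : Function.Involutive
      fun p : (ι → Y) × Y => (Function.update p.1 i p.2, p.1 i) := fun p => by simp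
  rw [← Fintype.sum_prod_type' fun τ t => F (Function.update τ i t)]
  have := Equiv.sum_comp hinv.toPerm fun p => F p.1
  simp only [Function.Involutive.coe_toPerm] at this
  rw [this, Fintype.sum_prod_type, Finset.mul_sum]
  simp

/-! ### Windows that contain a given time index -/

section Windows

variable {L : ℕ} {LC LF : ℕ} {a a' : Series L} {s : ℕ}

lemma padded_congr (h : ∀ i : Fin L, a i ≠ a' i → (i : ℕ) = s) {j : ℕ} (hj : j ≠ LC + s) :
    padded LC a j = padded LC a' j := by
  unfold padded
  split_ifs with hh
  · by_contra hne
    have := h _ hne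
    simp only at this
    omega
  · rfl

lemma contextWindow_congr (h : ∀ i : Fin L, a i ≠ a' i → (i : ℕ) = s) {t : ℕ}
    (ht : ¬ (t ≤ LC + s ∧ LC + s < t + LC + LF)) :
    contextWindow LC a t = contextWindow LC a' t :=
  funext fun i => padded_congr h (by have := i.2; omega)

lemma forecastWindow_congr (h : ∀ i : Fin L, a i ≠ a' i → (i : ℕ) = s) {t : ℕ}
    (ht : ¬ (t ≤ LC + s ∧ LC + s < t + LC + LF)) :
    forecastWindow LC LF a t = forecastWindow LC LF a' t :=
  funext fun i => padded_congr h (by have := i.2; omega)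

/-- At most `LC + LF` start indices select a subsequence that contains a given element. -/
lemma exists_superset_affected_starts (hL : LC + LF + LF ≤ L + 1) (s : ℕ) :
    ∃ S : Finset (Fin 1 → Fin (L - LF + 1)), S.card = LC + LF ∧
      ∀ y, y ∉ S → ¬ ((y 0 : ℕ) ≤ LC + s ∧ LC + s < y 0 + LC + LF) := by
  classical
  set S₀ : Finset (Fin 1 → Fin (L - LF + 1)) :=
    Finset.univ.filter fun y => (y 0 : ℕ) ≤ LC + s ∧ LC + s < y 0 + LC + LF with hS₀
  have h1 : S₀.card ≤ LC + LF := by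
    -- If s + 1 < LF the lower end truncates to 0 and there are fewer than LC + LF candidates.
    calc S₀.card ≤ (Finset.Icc (s + 1 - LF) (LC + s)).card := by
          refine Finset.card_le_card_of_injOn (fun y => (y 0 : ℕ)) (fun y hy => ?_) ?_
          · simp only [hS₀, Finset.coe_filter, Finset.mem_univ, true_and, Set.mem_ofPred_eq] at hy
            simp only [Finset.coe_Icc, Set.mem_Icc]
            omega
          · intro y _ y' _ h
            funext i
            rw [Subsingleton.elim i 0]
            exact Fin.ext h
      _ ≤ LC + LF := by rw [Nat.card_Icc]; omega
  -- Near the ends of the series fewer starts are affected. Padding to exactly LC + LF gives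
  -- proportion r and is harmless, since on `S` the components need not differ.
  obtain ⟨S, hS, hc⟩ := Finset.exists_superset_card_eq h1 (by simp; omega)
  refine ⟨S, hc, fun y hy h => hy (hS ?_)⟩
  simp [hS₀, h]

lemma card_starts_eq (hL : LC + LF + LF ≤ L + 1) (hLF : 0 < LF) :
    ((LC + LF : ℕ) : ℝ) = ((LC : ℝ) + LF) / ((L : ℝ) - LF + 1) *
      Fintype.card (Fin 1 → Fin (L - LF + 1)) := by
  have h1 : (0 : ℝ) < LF := by exact_mod_cast hLF
  have h2 : (LC : ℝ) + LF + LF ≤ L + 1 := by exact_mod_cast hL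
  have h3 : (0 : ℝ) ≤ LC := by positivity
  have h4 : (L : ℝ) - LF + 1 ≠ 0 := by linarith
  rw [Fintype.card_fun, Fintype.card_fin, Fintype.card_fin, pow_one]
  push_cast [show LF ≤ L by omega]
  field_simp

end Windows

/-! ### One training step -/

section Step

variable {N L D LC LF : ℕ}

lemma norm_clip_le {C : ℝ} (hC : 0 < C) (g : Param D) : ‖clip C g‖ ≤ C := by
  rw [clip, norm_smul, norm_inv, Real.norm_of_nonneg (by positivity),
    inv_mul_le_iff₀ (by positivity)]
  calc ‖g‖ = ‖g‖ / C * C := by field_simp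
    _ ≤ max 1 (‖g‖ / C) * C := by gcongr; exact le_max_right _ _

lemma measurable_clip (C : ℝ) : Measurable (clip C : Param D → Param D) := by
  unfold clip; fun_prop

lemma ForecastModel.measurable_grad (m : ForecastModel D LC LF) (c : Fin LC → ℝ)
    (y : Fin LF → ℝ) : Measurable fun θ => m.grad θ c y :=
  (InnerProductSpace.toDual ℝ (Param D)).symm.continuous.measurable.comp (measurable_fderiv ℝ _)

lemma measurable_clippedSum (m : ForecastModel D LC LF) (C : ℝ) (x : Dataset N L) {lam : ℕ}
    (B : Finset (Fin N)) (τ : StartIndices L LF lam B) :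
    Measurable fun θ => clippedSum m C x B τ θ :=
  Finset.measurable_sum _ fun _ _ => Finset.measurable_sum _ fun _ _ =>
    (measurable_clip C).comp (m.measurable_grad _ _)

instance isProbabilityMeasure_stepLaw (m : ForecastModel D LC LF) (lam Lam : ℕ) (C : ℝ) (σ : ℝ≥0)
    (x : Dataset N L) (B : Finset (Fin N)) (θ : Param D) :
    IsProbabilityMeasure (stepLaw m lam Lam C σ x B θ) := by
  refine ⟨?_⟩
  have h : ∀ τ : StartIndices L LF lam B, ((stdGaussian (Param D)).map fun z =>
      (Lam : ℝ)⁻¹ • (clippedSum m C x B τ θ + ((σ : ℝ) * C) • z)) Set.univ = 1 := fun τ => by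
    rw [Measure.map_apply (by fun_prop) MeasurableSet.univ]; simp
  rw [stepLaw, Measure.smul_apply, Measure.finsetSum_apply, Finset.sum_congr rfl fun τ _ => h τ,
    Finset.sum_const, Finset.card_univ, nsmul_eq_mul, mul_one, smul_eq_mul]
  exact ENNReal.inv_mul_cancel (by simp) (by simp)

lemma measurable_stepLaw (m : ForecastModel D LC LF) (lam Lam : ℕ) (C : ℝ) (σ : ℝ≥0)
    (x : Dataset N L) (B : Finset (Fin N)) : Measurable (stepLaw m lam Lam C σ x B) := by
  refine Measure.measurable_of_measurable_coe _ fun s hs => ?_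
  simp only [stepLaw, Measure.smul_apply, Measure.finsetSum_apply, smul_eq_mul]
  refine Measurable.const_mul (Finset.measurable_sum _ fun τ _ => ?_) _
  have hF : Measurable fun p : Param D × Param D =>
      (Lam : ℝ)⁻¹ • (clippedSum m C x B τ p.1 + ((σ : ℝ) * C) • p.2) := by
    have : Measurable fun p : Param D × Param D => clippedSum m C x B τ p.1 :=
      (measurable_clippedSum m C x B τ).comp measurable_fst
    fun_prop
  have := measurable_measure_prodMk_left (ν := stdGaussian (Param D)) (hF hs)
  convert this using 2 with θ
  rw [Measure.map_apply (by fun_prop) hs]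
  rfl

lemma lintegral_stepLaw (m : ForecastModel D LC LF) (lam Lam : ℕ) (C : ℝ) (σ : ℝ≥0)
    (x : Dataset N L) (B : Finset (Fin N)) (θ : Param D) {φ : Param D → ℝ≥0∞}
    (hφ : Measurable φ) :
    ∫⁻ g, φ g ∂stepLaw m lam Lam C σ x B θ =
      (Fintype.card (StartIndices L LF lam B) : ℝ≥0∞)⁻¹ * ∑ τ : StartIndices L LF lam B,
        ∫⁻ z, φ ((Lam : ℝ)⁻¹ • (clippedSum m C x B τ θ + ((σ : ℝ) * C) • z))
          ∂stdGaussian (Param D) := by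
  rw [stepLaw, lintegral_smul_measure, lintegral_finsetSum_measure, smul_eq_mul]
  congr 1
  exact Finset.sum_congr rfl fun τ _ => lintegral_map hφ (by fun_prop)

/-- The contribution of the sequence `n` can be split off the sum of clipped gradients. -/
lemma clippedSum_update (m : ForecastModel D LC LF) (C : ℝ) (x : Dataset N L)
    {B : Finset (Fin N)} (n : B) (τ : StartIndices L LF 1 B) (y : Fin 1 → Fin (L - LF + 1))
    (θ : Param D) :
    clippedSum m C x B (Function.update τ n y) θ =
      clip C (m.grad θ (contextWindow LC (x n) (y 0)) (forecastWindow LC LF (x n) (y 0))) +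
        ∑ k ∈ Finset.univ.erase n,
          clip C (m.grad θ (contextWindow LC (x k) (τ k 0)) (forecastWindow LC LF (x k) (τ k 0))) := by
  rw [clippedSum, ← Finset.add_sum_erase _ _ (Finset.mem_univ n)]
  simp only [Fin.sum_univ_one, Function.update_self]
  congr 1
  refine Finset.sum_congr rfl fun k hk => ?_
  rw [Function.update_of_ne (Finset.ne_of_mem_erase hk)]

lemma clippedSum_update_of_ne {m : ForecastModel D LC LF} {C : ℝ} {x x' : Dataset N L}
    {B : Finset (Fin N)} (n : B) (hx : ∀ k, k ≠ (n : Fin N) → x k = x' k)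
    (τ : StartIndices L LF 1 B) (y : Fin 1 → Fin (L - LF + 1)) (θ : Param D) :
    clippedSum m C x' B (Function.update τ n y) θ =
      clip C (m.grad θ (contextWindow LC (x' n) (y 0)) (forecastWindow LC LF (x' n) (y 0))) +
        ∑ k ∈ Finset.univ.erase n,
          clip C (m.grad θ (contextWindow LC (x k) (τ k 0)) (forecastWindow LC LF (x k) (τ k 0))) := by
  rw [clippedSum_update]
  congr 1
  refine Finset.sum_congr rfl fun k hk => ?_
  rw [hx k fun h => Finset.ne_of_mem_erase hk (Subtype.ext h)]

/-- The other series contribute the same sum on both sides, leaving two clipped gradients. The start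
indices `y` and `y'` may differ, as the averaging over all pairs requires. -/
lemma norm_clippedSum_sub_le {m : ForecastModel D LC LF} {C : ℝ} (hC : 0 < C) {x x' : Dataset N L}
    {B : Finset (Fin N)} (n : B) (hx : ∀ k, k ≠ (n : Fin N) → x k = x' k)
    (τ : StartIndices L LF 1 B) (y y' : Fin 1 → Fin (L - LF + 1)) (θ : Param D) :
    ‖clippedSum m C x B (Function.update τ n y) θ -
      clippedSum m C x' B (Function.update τ n y') θ‖ ≤ 2 * C := by
  rw [clippedSum_update, clippedSum_update_of_ne n hx, add_sub_add_right_eq_sub, two_mul]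
  exact (norm_sub_le _ _).trans (add_le_add (norm_clip_le hC _) (norm_clip_le hC _))

lemma stepLaw_congr {m : ForecastModel D LC LF} {lam Lam : ℕ} {C : ℝ} {σ : ℝ≥0}
    {x x' : Dataset N L} {B : Finset (Fin N)} (h : ∀ n ∈ B, x n = x' n) (θ : Param D) :
    stepLaw m lam Lam C σ x B θ = stepLaw m lam Lam C σ x' B θ := by
  have : ∀ τ : StartIndices L LF lam B, clippedSum m C x B τ θ = clippedSum m C x' B τ θ :=
    fun τ => Finset.sum_congr rfl fun n _ => by rw [h n n.2]
  simp only [stepLaw, this]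

lemma lintegral_stepLaw_le {m : ForecastModel D LC LF} {Lam : ℕ} {C : ℝ} (hC : 0 < C) {σ : ℝ≥0}
    (hσ : 0 < σ) (hLF : 0 < LF) (hL : LC + LF + LF ≤ L + 1) {x x' : Dataset N L}
    {B : Finset (Fin N)} (n : B) (hx : ∀ k, k ≠ (n : Fin N) → x k = x' k) {s : ℕ}
    (hs : ∀ i : Fin L, x n i ≠ x' n i → (i : ℕ) = s) (α : ℝ≥0) (θ : Param D)
    {φ : Param D → ℝ≥0∞} (hφ : Measurable φ) (hφ1 : ∀ o, φ o ≤ 1) :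
    ∫⁻ g, φ g ∂stepLaw m 1 Lam C σ x B θ ≤
      α * ∫⁻ g, φ g ∂stepLaw m 1 Lam C σ x' B θ + tightProfile L LC LF σ α := by
  rw [lintegral_stepLaw _ _ _ _ _ _ _ _ hφ, lintegral_stepLaw _ _ _ _ _ _ _ _ hφ]
  obtain ⟨S, hS, hSs⟩ := exists_superset_affected_starts (LC := LC) hL s
  set I : Dataset N L → StartIndices L LF 1 B → ℝ≥0∞ := fun x τ =>
    ∫⁻ z, φ ((Lam : ℝ)⁻¹ • (clippedSum m C x B τ θ + ((σ : ℝ) * C) • z))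
          ∂stdGaussian (Param D) with hI
  set h := tightProfile L LC LF σ α
  -- With the other start indices frozen, the mixture bound applies to the start index of `n`;
  -- `sum_sum_update` then averages over the frozen ones. The factor 1/Λ is absorbed into the test.
  have h1 : ∀ τ : StartIndices L LF 1 B, ∑ y, I x (Function.update τ n y) ≤
      α * ∑ y, I x' (Function.update τ n y) +
        Fintype.card (Fin 1 → Fin (L - LF + 1)) * h := fun τ =>
    sum_lintegral_le hσ hLF hL hC (S := S)
      (v := fun y => clippedSum m C x B (Function.update τ n y) θ)
      (w := fun y => clippedSum m C x' B (Function.update τ n y) θ)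
      (by rw [hS]; exact card_starts_eq hL hLF)
      (fun t u => norm_clippedSum_sub_le hC n hx τ t u θ)
      (fun y hy => by
        rw [clippedSum_update, clippedSum_update_of_ne n hx,
          contextWindow_congr (LF := LF) hs (hSs y hy), forecastWindow_congr hs (hSs y hy)])
      α (φ := fun g => φ ((Lam : ℝ)⁻¹ • g)) (hφ.comp (by fun_prop)) (fun o => hφ1 _)
  have h2 := Finset.sum_le_sum fun τ (_ : τ ∈ Finset.univ) => h1 τ
  rw [Finset.sum_add_distrib, ← Finset.mul_sum, sum_sum_update n (I x), sum_sum_update n (I x'),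
    Finset.sum_const, Finset.card_univ, nsmul_eq_mul] at h2
  have hT0 : (Fintype.card (Fin 1 → Fin (L - LF + 1)) : ℝ≥0∞) ≠ 0 := by simp
  have hTt : (Fintype.card (Fin 1 → Fin (L - LF + 1)) : ℝ≥0∞) ≠ ∞ := ENNReal.natCast_ne_top _
  have hK0 : (Fintype.card (StartIndices L LF 1 B) : ℝ≥0∞) ≠ 0 := by simp
  have hKt : (Fintype.card (StartIndices L LF 1 B) : ℝ≥0∞) ≠ ∞ := ENNReal.natCast_ne_top _
  change (Fintype.card (StartIndices L LF 1 B) : ℝ≥0∞)⁻¹ * ∑ τ, I x τ ≤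
    α * ((Fintype.card (StartIndices L LF 1 B) : ℝ≥0∞)⁻¹ * ∑ τ, I x' τ) + h
  change _ ≤ _ + (Fintype.card (StartIndices L LF 1 B) : ℝ≥0∞) * _ at h2
  generalize (Fintype.card (Fin 1 → Fin (L - LF + 1)) : ℝ≥0∞) = T at *
  generalize (Fintype.card (StartIndices L LF 1 B) : ℝ≥0∞) = K at *
  have h3 : T * ∑ τ, I x τ ≤ T * (α * ∑ τ, I x' τ + K * h) := by
    calc _ ≤ _ := h2
      _ = _ := by ring
  have h4 := (ENNReal.mul_le_mul_iff_right hT0 hTt).1 h3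
  calc K⁻¹ * ∑ τ, I x τ ≤ K⁻¹ * (α * ∑ τ, I x' τ + K * h) := by gcongr
    _ = α * (K⁻¹ * ∑ τ, I x' τ) + K⁻¹ * K * h := by ring
    _ = _ := by rw [ENNReal.inv_mul_cancel hK0 hKt, one_mul]

/-- Components with equal start indices are compared: both are images of equivalent real Gaussians
under one kernel, so a null test for one is null for the other. -/
lemma stepLaw_absolutelyContinuous {m : ForecastModel D LC LF} {Lam : ℕ} {C : ℝ} (hC : 0 < C)
    {σ : ℝ≥0} (hσ : 0 < σ) {x x' : Dataset N L}
    {B : Finset (Fin N)} (n : B) (hx : ∀ k, k ≠ (n : Fin N) → x k = x' k) (θ : Param D) :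
    stepLaw m 1 Lam C σ x B θ ≪ stepLaw m 1 Lam C σ x' B θ := by
  have hv : σ ^ 2 ≠ 0 := by positivity
  refine Measure.AbsolutelyContinuous.mk fun s hs h0 => ?_
  have hφ : Measurable (s.indicator (1 : Param D → ℝ≥0∞)) := measurable_one.indicator hs
  rw [← lintegral_indicator_one hs, lintegral_stepLaw _ _ _ _ _ _ _ _ hφ, mul_eq_zero,
    Finset.sum_eq_zero_iff] at h0 ⊢
  refine Or.inr fun τ _ => ?_
  have h1 := h0.resolve_left (ENNReal.inv_ne_zero.2 (ENNReal.natCast_ne_top _)) τ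
    (Finset.mem_univ _)
  have hn := norm_clippedSum_sub_le (m := m) hC n hx τ (τ n) (τ n) θ
  rw [Function.update_eq_self] at hn
  obtain ⟨ψ, hψ, -, e0, e2⟩ := exists_lintegral_gaussianReal_eq hC σ hn
    (φ := fun g => s.indicator 1 ((Lam : ℝ)⁻¹ • g)) (hφ.comp (by fun_prop))
    (fun o => Set.indicator_le_self' (fun _ _ => zero_le) _)
  rw [e2, lintegral_eq_zero_iff hψ] at h1
  rw [e0, lintegral_eq_zero_iff hψ]
  exact ((gaussianReal_absolutelyContinuous 0 hv).trans
    (gaussianReal_absolutelyContinuous' 2 hv)).ae_le h1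

end Step

/-! ### Composition of the steps of an epoch -/

section Epoch

variable {N L D LC LF : ℕ}

lemma measurable_finCons {D k : ℕ} : Measurable
    fun p : Param D × (Fin k → Param D) => (Fin.cons p.1 p.2 : Fin (k + 1) → Param D) := by
  refine measurable_pi_iff.2 fun i => ?_
  induction i using Fin.cases with
  | zero => simpa using measurable_fst
  | succ i => simpa [Function.comp_def] using (measurable_pi_apply i).comp measurable_snd

lemma measurable_finCons_left {D k : ℕ} (g : Param D) :
    Measurable fun o : Fin k → Param D => (Fin.cons g o : Fin (k + 1) → Param D) :=
  measurable_finCons.comp measurable_prodMk_left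

/-- The claims are proved jointly because measurability of the `k + 1` step law in θ rests on joint
measurability of the continuation in (θ, g), which in turn uses that the `k` step law is a Markov
kernel. -/
lemma measurable_stepsLaw_and_isProbabilityMeasure (m : ForecastModel D LC LF) (lam Lam : ℕ)
    (C : ℝ) (σ : ℝ≥0) (η : ℝ) (x : Dataset N L) (k b : ℕ) :
    Measurable (stepsLaw m lam Lam C σ η x k b) ∧
      (∀ θ, IsProbabilityMeasure (stepsLaw m lam Lam C σ η x k b θ)) ∧
      Measurable fun p : Param D × Param D =>
        (stepsLaw m lam Lam C σ η x k b (p.1 - η • p.2)).map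
          (fun o => (Fin.cons p.2 o : Fin (k + 1) → Param D)) := by
  have aux : ∀ k b, Measurable (stepsLaw m lam Lam C σ η x k b) →
      (∀ θ, IsProbabilityMeasure (stepsLaw m lam Lam C σ η x k b θ)) →
      Measurable fun p : Param D × Param D =>
        (stepsLaw m lam Lam C σ η x k b (p.1 - η • p.2)).map
          (fun o => (Fin.cons p.2 o : Fin (k + 1) → Param D)) := by
    intro k b h1 h2
    let κ : Kernel (Param D × Param D) (Fin k → Param D) :=
      ⟨fun p => stepsLaw m lam Lam C σ η x k b (p.1 - η • p.2), h1.comp (by fun_prop)⟩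
    have : IsMarkovKernel κ := ⟨fun p => h2 _⟩
    refine Measure.measurable_of_measurable_coe _ fun s hs => ?_
    have hc : Measurable fun q : (Param D × Param D) × (Fin k → Param D) =>
        (Fin.cons q.1.2 q.2 : Fin (k + 1) → Param D) :=
      measurable_finCons.comp ((measurable_snd.comp measurable_fst).prodMk measurable_snd)
    convert Kernel.measurable_kernel_prodMk_left (κ := κ) (hc hs) using 2 with p
    rw [Measure.map_apply (measurable_finCons_left _) hs]
    rfl
  induction k generalizing b with
  | zero =>
    have h1 : Measurable (stepsLaw m lam Lam C σ η x 0 b) := measurable_const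
    have h2 : ∀ θ, IsProbabilityMeasure (stepsLaw m lam Lam C σ η x 0 b θ) := fun θ => by
      unfold stepsLaw; infer_instance
    exact ⟨h1, h2, aux 0 b h1 h2⟩
  | succ k ih =>
    obtain ⟨-, ih2, ih3⟩ := ih (b + 1)
    have hg : ∀ θ, Measurable fun g => (stepsLaw m lam Lam C σ η x k (b + 1) (θ - η • g)).map
        (fun o => (Fin.cons g o : Fin (k + 1) → Param D)) := fun θ =>
      ih3.comp measurable_prodMk_left
    have h1 : Measurable (stepsLaw m lam Lam C σ η x (k + 1) b) := by
      let κ : Kernel (Param D) (Param D) :=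
        ⟨stepLaw m lam Lam C σ x (topLevelBatch N (Lam / lam) b), measurable_stepLaw _ _ _ _ _ _ _⟩
      have : IsMarkovKernel κ := ⟨fun p => isProbabilityMeasure_stepLaw _ _ _ _ _ _ _ _⟩
      refine Measure.measurable_of_measurable_coe _ fun s hs => ?_
      convert! Measurable.lintegral_kernel_prod_right' (κ := κ)
        ((Measure.measurable_coe hs).comp ih3) using 2 with θ
      rw [stepsLaw, Measure.bind_apply hs (hg θ).aemeasurable]
      rfl
    have h2 : ∀ θ, IsProbabilityMeasure (stepsLaw m lam Lam C σ η x (k + 1) b θ) := fun θ => by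
      refine ⟨?_⟩
      rw [stepsLaw, Measure.bind_apply MeasurableSet.univ (hg θ).aemeasurable]
      have : ∀ g, (stepsLaw m lam Lam C σ η x k (b + 1) (θ - η • g)).map
          (fun o => (Fin.cons g o : Fin (k + 1) → Param D)) Set.univ = 1 := fun g => by
        rw [Measure.map_apply (measurable_finCons_left _) MeasurableSet.univ]
        simp
      simp [this]
    exact ⟨h1, h2, aux _ b h1 h2⟩

instance isProbabilityMeasure_stepsLaw (m : ForecastModel D LC LF) (lam Lam : ℕ)
    (C : ℝ) (σ : ℝ≥0) (η : ℝ) (x : Dataset N L) (k b : ℕ) (θ : Param D) :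
    IsProbabilityMeasure (stepsLaw m lam Lam C σ η x k b θ) :=
  (measurable_stepsLaw_and_isProbabilityMeasure m lam Lam C σ η x k b).2.1 θ

instance isProbabilityMeasure_epochLaw (m : ForecastModel D LC LF) (lam Lam : ℕ)
    (C : ℝ) (σ : ℝ≥0) (η : ℝ) (θ : Param D) (x : Dataset N L) :
    IsProbabilityMeasure (epochLaw m lam Lam C σ η θ x) := by
  unfold epochLaw; infer_instance

lemma measurable_lintegral_stepsLaw (m : ForecastModel D LC LF) (lam Lam : ℕ)
    (C : ℝ) (σ : ℝ≥0) (η : ℝ) (x : Dataset N L) (k b : ℕ) (θ : Param D)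
    {φ : (Fin (k + 1) → Param D) → ℝ≥0∞} (hφ : Measurable φ) :
    Measurable fun g => ∫⁻ o, φ (Fin.cons g o) ∂stepsLaw m lam Lam C σ η x k b (θ - η • g) := by
  have h := (Measure.measurable_lintegral hφ).comp
    ((measurable_stepsLaw_and_isProbabilityMeasure m lam Lam C σ η x k b).2.2.comp
      (measurable_prodMk_left (x := θ)))
  convert h using 2 with g
  exact (lintegral_map hφ (measurable_finCons_left _)).symm

lemma lintegral_stepsLaw_succ (m : ForecastModel D LC LF) (lam Lam : ℕ)
    (C : ℝ) (σ : ℝ≥0) (η : ℝ) (x : Dataset N L) (k b : ℕ) (θ : Param D)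
    {φ : (Fin (k + 1) → Param D) → ℝ≥0∞} (hφ : Measurable φ) :
    ∫⁻ o, φ o ∂stepsLaw m lam Lam C σ η x (k + 1) b θ =
      ∫⁻ g, ∫⁻ o, φ (Fin.cons g o) ∂stepsLaw m lam Lam C σ η x k (b + 1) (θ - η • g)
        ∂stepLaw m lam Lam C σ x (topLevelBatch N (Lam / lam) b) θ := by
  have hg : Measurable fun g => (stepsLaw m lam Lam C σ η x k (b + 1) (θ - η • g)).map
      (fun o => (Fin.cons g o : Fin (k + 1) → Param D)) :=
    (measurable_stepsLaw_and_isProbabilityMeasure m lam Lam C σ η x k (b + 1)).2.2.comp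
      measurable_prodMk_left
  rw [stepsLaw, Measure.lintegral_bind hg.aemeasurable hφ.aemeasurable]
  exact lintegral_congr fun g =>
    lintegral_map hφ (measurable_finCons_left _)

lemma stepsLaw_congr {m : ForecastModel D LC LF} {lam Lam : ℕ} {C : ℝ} {σ : ℝ≥0} {η : ℝ}
    {x x' : Dataset N L} (k : ℕ) {b : ℕ}
    (h : ∀ c, b ≤ c → ∀ n ∈ topLevelBatch N (Lam / lam) c, x n = x' n) (θ : Param D) :
    stepsLaw m lam Lam C σ η x k b θ = stepsLaw m lam Lam C σ η x' k b θ := by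
  induction k generalizing b θ with
  | zero => rfl
  | succ k ih =>
    simp only [stepsLaw]
    rw [stepLaw_congr (h b le_rfl)]
    have hk : ∀ θ, stepsLaw m lam Lam C σ η x k (b + 1) θ =
        stepsLaw m lam Lam C σ η x' k (b + 1) θ := ih fun c hc => h c (by omega)
    simp only [hk]

/-- A sequence occurs in at most one top-level batch. -/
lemma ne_of_mem_topLevelBatch_of_lt {N' b c : ℕ} {n k : Fin N} (hn : n ∈ topLevelBatch N N' b)
    (hbc : b < c) (hk : k ∈ topLevelBatch N N' c) : k ≠ n := by
  rintro rfl
  simp only [topLevelBatch, Finset.mem_filter, Finset.mem_univ, true_and] at hn hk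
  have := Nat.mul_le_mul_right N' (Nat.succ_le_of_lt hbc)
  simp only [Nat.succ_eq_add_one] at this
  omega

/-- The additive term is charged only once: either the current batch contains `n` and the
continuation is common to both datasets, or the current step is common and the loss is deferred. -/
lemma lintegral_stepsLaw_le {m : ForecastModel D LC LF} {Lam : ℕ} {C : ℝ} (hC : 0 < C) {σ : ℝ≥0}
    (hσ : 0 < σ) {η : ℝ} (hLF : 0 < LF) (hL : LC + LF + LF ≤ L + 1) {x x' : Dataset N L}
    {n : Fin N} (hx : ∀ k, k ≠ n → x k = x' k) {s : ℕ}
    (hs : ∀ i : Fin L, x n i ≠ x' n i → (i : ℕ) = s) (α : ℝ≥0) (k b : ℕ) (θ : Param D)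
    {φ : (Fin k → Param D) → ℝ≥0∞} (hφ : Measurable φ) (hφ1 : ∀ o, φ o ≤ 1) :
    ∫⁻ o, φ o ∂stepsLaw m 1 Lam C σ η x k b θ ≤
      α * ∫⁻ o, φ o ∂stepsLaw m 1 Lam C σ η x' k b θ + tightProfile L LC LF σ α := by
  induction k generalizing b θ with
  | zero =>
    simp only [stepsLaw, lintegral_dirac]
    calc φ Fin.elim0 = 1 * φ Fin.elim0 := (one_mul _).symm
      _ ≤ (α + tightProfile L LC LF σ α) * φ Fin.elim0 := by
        gcongr; exact one_le_add_tightProfile hσ hLF hL α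
      _ ≤ α * φ Fin.elim0 + tightProfile L LC LF σ α * 1 := by
        rw [add_mul]; gcongr; exact hφ1 _
      _ = _ := by rw [mul_one]
  | succ k ih =>
    rw [lintegral_stepsLaw_succ _ _ _ _ _ _ _ _ _ _ hφ,
      lintegral_stepsLaw_succ _ _ _ _ _ _ _ _ _ _ hφ]
    have hm := measurable_lintegral_stepsLaw m 1 Lam C σ η x' k (b + 1) θ hφ
    by_cases hn : n ∈ topLevelBatch N (Lam / 1) b
    · have hc : ∀ g, stepsLaw m 1 Lam C σ η x k (b + 1) (θ - η • g) =
          stepsLaw m 1 Lam C σ η x' k (b + 1) (θ - η • g) := fun g =>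
        stepsLaw_congr k (fun c hc j hj => hx j (ne_of_mem_topLevelBatch_of_lt hn hc hj)) _
      simp only [hc]
      -- Integrating φ over the common continuation gives a test in the current gradient, still
      -- bounded by 1.
      exact lintegral_stepLaw_le hC hσ hLF hL (⟨n, hn⟩ : topLevelBatch N (Lam / 1) b) hx hs α θ hm
        fun g => (lintegral_mono fun o => hφ1 _).trans (by simp)
    · rw [stepLaw_congr fun j hj => hx j fun h => hn (h ▸ hj)]
      calc _ ≤ ∫⁻ g, (α * ∫⁻ o, φ (Fin.cons g o)
              ∂stepsLaw m 1 Lam C σ η x' k (b + 1) (θ - η • g) + tightProfile L LC LF σ α)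
              ∂stepLaw m 1 Lam C σ x' (topLevelBatch N (Lam / 1) b) θ :=
            lintegral_mono fun g => ih (b + 1) (θ - η • g)
              (hφ.comp (measurable_finCons_left _)) fun o => hφ1 _
        _ = _ := by
          rw [lintegral_add_right _ measurable_const, lintegral_const_mul _ hm]
          simp

lemma stepsLaw_absolutelyContinuous {m : ForecastModel D LC LF} {Lam : ℕ} {C : ℝ} (hC : 0 < C)
    {σ : ℝ≥0} (hσ : 0 < σ) {η : ℝ} {x x' : Dataset N L}
    {n : Fin N} (hx : ∀ k, k ≠ n → x k = x' k) (k b : ℕ) (θ : Param D) :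
    stepsLaw m 1 Lam C σ η x k b θ ≪ stepsLaw m 1 Lam C σ η x' k b θ := by
  induction k generalizing b θ with
  | zero => exact Measure.AbsolutelyContinuous.rfl
  | succ k ih =>
    have hstep : stepLaw m 1 Lam C σ x (topLevelBatch N (Lam / 1) b) θ ≪
        stepLaw m 1 Lam C σ x' (topLevelBatch N (Lam / 1) b) θ := by
      by_cases hn : n ∈ topLevelBatch N (Lam / 1) b
      · exact stepLaw_absolutelyContinuous hC hσ (⟨n, hn⟩ : topLevelBatch N (Lam / 1) b) hx θ
      · rw [stepLaw_congr fun j hj => hx j fun h => hn (h ▸ hj)]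
    refine Measure.AbsolutelyContinuous.mk fun s hs h0 => ?_
    have hφ : Measurable (s.indicator (1 : (Fin (k + 1) → Param D) → ℝ≥0∞)) :=
      measurable_one.indicator hs
    rw [← lintegral_indicator_one hs, lintegral_stepsLaw_succ _ _ _ _ _ _ _ _ _ _ hφ,
      lintegral_eq_zero_iff (measurable_lintegral_stepsLaw _ _ _ _ _ _ _ _ _ _ hφ)] at h0 ⊢
    filter_upwards [hstep.ae_le h0] with g hg
    have hφg : Measurable fun o : Fin k → Param D =>
        s.indicator (1 : (Fin (k + 1) → Param D) → ℝ≥0∞) (Fin.cons g o) :=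
      hφ.comp (measurable_finCons_left _)
    rw [Pi.zero_apply, lintegral_eq_zero_iff hφg] at hg ⊢
    exact (ih (b + 1) (θ - η • g)).ae_le hg

lemma privacyProfile_le {m : ForecastModel D LC LF} {Lam : ℕ} {C : ℝ} (hC : 0 < C) {σ : ℝ≥0}
    (hσ : 0 < σ) {η : ℝ} {θ₀ : Param D} (hLF : 0 < LF) (hL : LC + LF + LF ≤ L + 1) (α : ℝ≥0) :
    privacyProfile N L m 1 Lam C σ η θ₀ α ≤ tightProfile L LC LF σ α := by
  refine iSup_le fun x => iSup_le fun x' => iSup_le fun ⟨n, hx, _, t, ht⟩ => ?_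
  refine hockeyStick_le fun s hs => ?_
  rw [← lintegral_indicator_one hs, ← lintegral_indicator_one hs]
  -- A range of width one forces every differing index to equal `t`.
  exact lintegral_stepsLaw_le hC hσ hLF hL hx (s := t)
    (fun i hi => by have := ht i hi; omega) α _ _ _ (measurable_one.indicator hs)
    fun o => Set.indicator_le_self' (fun _ _ => zero_le) _

end Epoch

/-! ### A model and datasets attaining the bound -/

section WorstCase

variable {N L D LC LF : ℕ}

/-- A subsequence contains the value `1`. -/
def ContainsOne (c : Fin LC → ℝ) (y : Fin LF → ℝ) : Prop := (∃ i, c i = 1) ∨ ∃ i, y i = 1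

open Classical in
/-- The worst-case model: the gradient of its loss is `C • e` on subsequences that contain the
value `1` and `-C • e` on all others. -/
noncomputable def detectorModel (LC LF : ℕ) (e : Param D) (C : ℝ) : ForecastModel D LC LF where
  Out := Param D × (Fin LC → ℝ)
  predict θ c := (θ, c)
  loss o y := inner ℝ ((if ContainsOne o.2 y then C else -C) • e) o.1
  differentiable_loss c y :=
    (innerSL ℝ ((if ContainsOne c y then C else -C) • e)).differentiable

open Classical in
lemma clip_grad_detectorModel {e : Param D} (he : ‖e‖ = 1) {C : ℝ} (hC : 0 < C) (θ : Param D)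
    (c : Fin LC → ℝ) (y : Fin LF → ℝ) :
    clip C ((detectorModel LC LF e C).grad θ c y) = (if ContainsOne c y then C else -C) • e := by
  have hg : (detectorModel LC LF e C).grad θ c y = (if ContainsOne c y then C else -C) • e := by
    refine HasGradientAt.gradient ?_
    rw [hasGradientAt_iff_hasFDerivAt]
    exact (innerSL ℝ ((if ContainsOne c y then C else -C) • e)).hasFDerivAt
  have hn : ‖(if ContainsOne c y then C else -C) • e‖ = C := by
    rw [norm_smul, he, mul_one]
    split_ifs <;> simp [abs_of_pos hC]
  rw [hg, clip, hn, div_self hC.ne', max_self, inv_one, one_smul]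

/-- The dataset of the constant series `2, 3, …`. -/
noncomputable def constantDataset (N L : ℕ) (s : Fin L) : Dataset N L where
  -- The shift by 2 keeps the values away from the padding value 0 and from the marker 1.
  toFun n _ := (n : ℝ) + 2
  inj' n n' h := by
    have := congrFun h s
    simpa [Fin.ext_iff] using this

@[simp]
lemma constantDataset_apply (n : Fin N) (s i : Fin L) :
    constantDataset N L s n i = (n : ℝ) + 2 := rfl

/-- The dataset of the constant series `2, 3, …`, where the element `s` of the sequence `n` is
replaced with `1`. -/
noncomputable def spikedDataset {N L : ℕ} (n : Fin N) (s : Fin L) : Dataset N L where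
  toFun := Function.update (constantDataset N L s) n
    (Function.update (constantDataset N L s n) s 1)
  inj' k k' h := by
    have hv : ∀ j : Fin N, Function.update (⇑(constantDataset N L s)) n
        (Function.update (constantDataset N L s n) s 1) j s =
        if j = n then (1 : ℝ) else (j : ℝ) + 2 := fun j => by
      rcases eq_or_ne j n with rfl | hj
      · simp
      · simp [hj]
    have h1 := congrFun h s
    rw [hv, hv] at h1
    split_ifs at h1 with h2 h3 h3
    · rw [h2, h3]
    · have : (0 : ℝ) ≤ (k' : ℕ) := by positivity
      linarith
    · have : (0 : ℝ) ≤ (k : ℕ) := by positivity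
      linarith
    · exact Fin.ext (by exact_mod_cast add_right_cancel h1)

lemma spikedDataset_of_ne {n k : Fin N} (s : Fin L) (h : k ≠ n) :
    spikedDataset n s k = constantDataset N L s k :=
  Function.update_of_ne h _ _

lemma spikedDataset_self (n : Fin N) (s : Fin L) :
    spikedDataset n s n = Function.update (constantDataset N L s n) s 1 :=
  Function.update_self _ _ _

lemma padded_constantDataset_ne_one (n : Fin N) (s : Fin L) (j : ℕ) :
    padded LC (constantDataset N L s n) j ≠ 1 := by
  unfold padded
  split_ifs
  · have : (0 : ℝ) ≤ (n : ℕ) := by positivity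
    rw [constantDataset_apply]
    linarith
  · norm_num

lemma padded_spikedDataset_eq_one_iff (n : Fin N) (s : Fin L) (j : ℕ) :
    padded LC (spikedDataset n s n) j = 1 ↔ j = LC + s := by
  rw [spikedDataset_self]
  constructor
  · intro h
    by_contra hj
    rw [padded_congr (a' := constantDataset N L s n) (s := s) (fun i hi => ?_) hj] at h
    · exact padded_constantDataset_ne_one n s j h
    · by_contra hne
      exact hi (Function.update_of_ne (fun h => hne (congrArg Fin.val h)) _ _)
  · rintro rfl
    have hs : LC ≤ LC + s ∧ LC + s - LC < L := ⟨by omega, by have := s.2; omega⟩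
    have : (⟨LC + s - LC, hs.2⟩ : Fin L) = s := Fin.ext (by simp)
    rw [padded, dif_pos hs, this, Function.update_self]

lemma not_containsOne_constantDataset (n : Fin N) (s : Fin L) (t : ℕ) :
    ¬ ContainsOne (contextWindow LC (constantDataset N L s n) t)
      (forecastWindow LC LF (constantDataset N L s n) t) := by
  rintro (⟨i, hi⟩ | ⟨i, hi⟩) <;> exact padded_constantDataset_ne_one n s _ hi

/-- The marker sits at padded position LC + LF - 1, the last entry of the window starting at 0.
Every start up to that position reaches it, so the maximal number of affected starts is attained. -/
lemma containsOne_spikedDataset_iff (n : Fin N) {s : Fin L} (hs : (s : ℕ) + 1 = LF) (t : ℕ) :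
    ContainsOne (contextWindow LC (spikedDataset n s n) t)
      (forecastWindow LC LF (spikedDataset n s n) t) ↔ t < LC + LF := by
  simp only [ContainsOne, contextWindow, forecastWindow, padded_spikedDataset_eq_one_iff]
  constructor
  · rintro (⟨i, hi⟩ | ⟨i, hi⟩) <;> omega
  · intro ht
    by_cases h : s < t
    · exact Or.inl ⟨⟨LC + s - t, by omega⟩, by simp only; omega⟩
    · exact Or.inr ⟨⟨s - t, by omega⟩, by simp only; omega⟩

lemma eventNeighbor_spikedDataset (n : Fin N) (s : Fin L) :
    EventNeighbor 1 (spikedDataset n s) (constantDataset N L s) ∧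
      EventNeighbor 1 (constantDataset N L s) (spikedDataset n s) := by
  have h1 : spikedDataset n s n s ≠ constantDataset N L s n s := by
    have : (0 : ℝ) ≤ (n : ℕ) := by positivity
    rw [spikedDataset_self, Function.update_self]
    rw [constantDataset_apply]
    linarith
  have h2 : ∀ i, i ≠ s → spikedDataset n s n i = constantDataset N L s n i := fun i hi => by
    rw [spikedDataset_self, Function.update_of_ne hi]
  have h3 : ∀ i : Fin L, i = s → (s : ℕ) ≤ i ∧ (i : ℕ) < s + 1 := by rintro i rfl; simp
  refine ⟨⟨n, fun k hk => spikedDataset_of_ne s hk, fun h => h1 (congrFun h s), s, fun i hi =>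
    h3 i ?_⟩, ⟨n, fun k hk => (spikedDataset_of_ne s hk).symm, fun h => h1 (congrFun h s).symm, s,
    fun i hi => h3 i ?_⟩⟩
  · by_contra h; exact hi (h2 i h)
  · by_contra h; exact hi (h2 i h).symm

lemma clippedSum_constantDataset {e : Param D} (he : ‖e‖ = 1) {C : ℝ} (hC : 0 < C)
    (B : Finset (Fin N)) (s : Fin L) (τ : StartIndices L LF 1 B) (θ : Param D) :
    clippedSum (detectorModel LC LF e C) C (constantDataset N L s) B τ θ =
      (-(B.card * C)) • e := by
  simp only [clippedSum, clip_grad_detectorModel he hC,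
    if_neg (not_containsOne_constantDataset _ _ _), Finset.sum_const,
    Finset.card_univ, Fintype.card_coe, Fintype.card_fin, ← Nat.cast_smul_eq_nsmul ℝ, smul_smul]
  push_cast
  rw [one_mul, mul_neg]

/-- Detecting the marker flips one summand from -C e to C e, a shift by 2C e: the extreme case of
clipping and the origin of the mean 2. -/
lemma clippedSum_spikedDataset {e : Param D} (he : ‖e‖ = 1) {C : ℝ} (hC : 0 < C)
    {B : Finset (Fin N)} (n : B) {s : Fin L} (hs : (s : ℕ) + 1 = LF)
    (τ : StartIndices L LF 1 B) (θ : Param D) :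
    clippedSum (detectorModel LC LF e C) C (spikedDataset (n : Fin N) s) B τ θ =
      (-(B.card * C) + C * if (τ n 0 : ℕ) < LC + LF then 2 else 0) • e := by
  have h1 := clippedSum_update (detectorModel LC LF e C) C (spikedDataset (n : Fin N) s) n τ
    (τ n) θ
  have h2 := clippedSum_update_of_ne (m := detectorModel LC LF e C) (C := C)
    (x' := constantDataset N L s) n (fun k hk => spikedDataset_of_ne s hk) τ (τ n) θ
  rw [Function.update_eq_self, clip_grad_detectorModel he hC,
    containsOne_spikedDataset_iff _ hs] at h1
  rw [Function.update_eq_self, clippedSum_constantDataset he hC, clip_grad_detectorModel he hC,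
    if_neg (not_containsOne_constantDataset _ _ _)] at h2
  rw [h1, ← sub_eq_iff_eq_add'.2 h2, ← sub_smul]
  rw [← add_smul]
  congr 1
  split_ifs <;> ring

lemma map_inner_stdGaussian {e : Param D} (he : ‖e‖ = 1) (a : ℝ) (σ : ℝ≥0) :
    (stdGaussian (Param D)).map (fun z => a + (σ : ℝ) * inner ℝ e z) =
      gaussianReal a (σ ^ 2) := by
  have h1 : (stdGaussian (Param D)).map (fun z => inner ℝ e z) = gaussianReal 0 1 := by
    have h := IsGaussian.map_eq_gaussianReal (μ := stdGaussian (Param D)) (innerSL ℝ e)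
    rw [integral_strongDual_stdGaussian, variance_dual_stdGaussian, innerSL_apply_norm, he] at h
    simpa using h
  have h2 : (fun z : Param D => a + (σ : ℝ) * inner ℝ e z) =
      (fun y => a + y) ∘ (fun y => (σ : ℝ) * y) ∘ fun z => inner ℝ e z := rfl
  rw [h2, ← Measure.map_map (by fun_prop) (by fun_prop), ← Measure.map_map (by fun_prop)
    (by fun_prop), h1, gaussianReal_map_const_mul, gaussianReal_map_const_add]
  congr 1
  · simp
  · ext; simp

/-- The released gradient in direction `e`, normalized such that the noise has scale `σ`. -/
noncomputable def directionalStatistic (Lam b : ℕ) (C : ℝ) (e g : Param D) : ℝ :=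
  (Lam * inner ℝ e g + b * C) / C

lemma measurable_directionalStatistic (Lam b : ℕ) (C : ℝ) (e : Param D) :
    Measurable (directionalStatistic Lam b C e) := by
  unfold directionalStatistic; fun_prop

/-- The statistic undoes 1/Λ, the constant offset -bC and the scale C, leaving a + σ⟨e, z⟩. -/
lemma lintegral_directionalStatistic {Lam b : ℕ} (hLam : 0 < Lam) {C : ℝ} (hC : 0 < C)
    {e : Param D} (he : ‖e‖ = 1) (σ : ℝ≥0) (a : ℝ) {ψ : ℝ → ℝ≥0∞} (hψ : Measurable ψ) :
    ∫⁻ z, ψ (directionalStatistic Lam b C e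
        ((Lam : ℝ)⁻¹ • ((-(b * C) + C * a) • e + ((σ : ℝ) * C) • z))) ∂stdGaussian (Param D) =
      ∫⁻ y, ψ y ∂gaussianReal a (σ ^ 2) := by
  rw [← map_inner_stdGaussian he a σ, lintegral_map hψ (by fun_prop)]
  refine lintegral_congr fun z => ?_
  congr 1
  have hL : (Lam : ℝ) ≠ 0 := by positivity
  rw [directionalStatistic, real_inner_smul_right, inner_add_right, real_inner_smul_right,
    real_inner_smul_right, real_inner_self_eq_norm_sq, he]
  field_simp
  ring

lemma lintegral_stepLaw_constantDataset {Lam : ℕ} (hLam : 0 < Lam) {C : ℝ} (hC : 0 < C)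
    {e : Param D} (he : ‖e‖ = 1) (σ : ℝ≥0) (s : Fin L) (B : Finset (Fin N)) (θ : Param D)
    {ψ : ℝ → ℝ≥0∞} (hψ : Measurable ψ) :
    ∫⁻ g, ψ (directionalStatistic Lam B.card C e g)
        ∂stepLaw (detectorModel LC LF e C) 1 Lam C σ (constantDataset N L s) B θ =
      ∫⁻ y, ψ y ∂gaussianReal 0 (σ ^ 2) := by
  rw [lintegral_stepLaw (φ := fun g => ψ (directionalStatistic Lam B.card C e g)) _ _ _ _ _ _ _ _
    (hψ.comp (measurable_directionalStatistic _ _ _ _))]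
  have h : ∀ τ : StartIndices L LF 1 B, ∫⁻ z, ψ (directionalStatistic Lam B.card C e
      ((Lam : ℝ)⁻¹ • (clippedSum (detectorModel LC LF e C) C (constantDataset N L s) B τ θ +
        ((σ : ℝ) * C) • z))) ∂stdGaussian (Param D) = ∫⁻ y, ψ y ∂gaussianReal 0 (σ ^ 2) :=
    fun τ => by
      rw [clippedSum_constantDataset he hC, ← lintegral_directionalStatistic (b := B.card) hLam hC
        he σ 0 hψ]
      simp
  rw [Finset.sum_congr rfl fun τ _ => h τ, Finset.sum_const, Finset.card_univ, nsmul_eq_mul,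
    ← mul_assoc, ENNReal.inv_mul_cancel (by simp) (ENNReal.natCast_ne_top _), one_mul]

lemma lintegral_stepLaw_spikedDataset {Lam : ℕ} (hLam : 0 < Lam) {C : ℝ} (hC : 0 < C)
    {e : Param D} (he : ‖e‖ = 1) (σ : ℝ≥0) (hL : LC + LF + LF ≤ L + 1)
    {s : Fin L} (hs : (s : ℕ) + 1 = LF) {B : Finset (Fin N)} (n : B) (θ : Param D)
    {ψ : ℝ → ℝ≥0∞} (hψ : Measurable ψ) :
    ∫⁻ g, ψ (directionalStatistic Lam B.card C e g)
        ∂stepLaw (detectorModel LC LF e C) 1 Lam C σ (spikedDataset (n : Fin N) s) B θ =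
      ∫⁻ y, ψ y ∂mixtureP L LC LF σ := by
  rw [lintegral_stepLaw (φ := fun g => ψ (directionalStatistic Lam B.card C e g)) _ _ _ _ _ _ _ _
    (hψ.comp (measurable_directionalStatistic _ _ _ _)),
    lintegral_mixtureP]
  set I₀ := ∫⁻ y, ψ y ∂gaussianReal 0 (σ ^ 2)
  set I₂ := ∫⁻ y, ψ y ∂gaussianReal 2 (σ ^ 2)
  set F : StartIndices L LF 1 B → ℝ≥0∞ := fun τ =>
    if (τ n 0 : ℕ) < LC + LF then I₂ else I₀ with hF
  have h : ∀ τ : StartIndices L LF 1 B, ∫⁻ z, ψ (directionalStatistic Lam B.card C e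
      ((Lam : ℝ)⁻¹ • (clippedSum (detectorModel LC LF e C) C (spikedDataset (n : Fin N) s) B τ θ +
        ((σ : ℝ) * C) • z))) ∂stdGaussian (Param D) = F τ :=
    fun τ => by
      rw [clippedSum_spikedDataset he hC n hs, lintegral_directionalStatistic hLam hC he σ _ hψ, hF]
      dsimp only
      split_ifs <;> rfl
  have hT : (Fintype.card (Fin 1 → Fin (L - LF + 1))) = L - LF + 1 := by simp
  have hcard : (Finset.univ.filter fun i : Fin (L - LF + 1) => (i : ℕ) < LC + LF).card =
      LC + LF := by
    rw [Fin.card_filter_val_lt]; omega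
  have hcard' : (Finset.univ.filter fun i : Fin (L - LF + 1) => ¬ (i : ℕ) < LC + LF).card =
      L - LF + 1 - (LC + LF) := by
    have := Finset.card_filter_add_card_filter_not (s := Finset.univ)
      fun i : Fin (L - LF + 1) => (i : ℕ) < LC + LF
    rw [hcard, Finset.card_univ, Fintype.card_fin] at this
    omega
  -- Resampling the start index of `n` turns the average over all start indices into a count: LC +
  -- LF starts give mean 2, the others mean 0.
  have hsum := sum_sum_update n F
  have hin : ∀ τ : StartIndices L LF 1 B, ∑ y, F (Function.update τ n y) =
      (LC + LF : ℕ) * I₂ + (L - LF + 1 - (LC + LF) : ℕ) * I₀ := fun τ => by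
    simp only [hF, Function.update_self]
    rw [← Equiv.sum_comp (Equiv.funUnique (Fin 1) (Fin (L - LF + 1))).symm
      fun y => if (y 0 : ℕ) < LC + LF then I₂ else I₀]
    simp only [Equiv.funUnique_symm_apply, uniqueElim_const]
    rw [Finset.sum_ite, Finset.sum_const, Finset.sum_const, hcard, hcard', nsmul_eq_mul,
      nsmul_eq_mul]
  rw [Finset.sum_congr rfl fun τ _ => hin τ, Finset.sum_const, Finset.card_univ, nsmul_eq_mul,
    hT] at hsum
  rw [Finset.sum_congr rfl fun τ _ => h τ]
  have hTR : ((L : ℝ) - LF + 1) = ((L - LF + 1 : ℕ) : ℝ) := by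
    push_cast [show LF ≤ L by omega]; ring
  have hTpos : (0 : ℝ) < ((L - LF + 1 : ℕ) : ℝ) := by positivity
  have hr : ENNReal.ofReal (((LC : ℝ) + LF) / ((L : ℝ) - LF + 1)) =
      ((L - LF + 1 : ℕ) : ℝ≥0∞)⁻¹ * (LC + LF : ℕ) := by
    rw [hTR, ENNReal.ofReal_div_of_pos hTpos, ENNReal.ofReal_natCast, ← Nat.cast_add,
      ENNReal.ofReal_natCast, div_eq_mul_inv, mul_comm]
  have hr' : ENNReal.ofReal (1 - ((LC : ℝ) + LF) / ((L : ℝ) - LF + 1)) =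
      ((L - LF + 1 : ℕ) : ℝ≥0∞)⁻¹ * (L - LF + 1 - (LC + LF) : ℕ) := by
    have : 1 - ((LC : ℝ) + LF) / ((L : ℝ) - LF + 1) =
        ((L - LF + 1 - (LC + LF) : ℕ) : ℝ) / ((L - LF + 1 : ℕ) : ℝ) := by
      rw [hTR, Nat.cast_sub (by omega), eq_div_iff hTpos.ne', sub_mul, one_mul,
        div_mul_cancel₀ _ hTpos.ne', Nat.cast_add LC]
    rw [this, ENNReal.ofReal_div_of_pos hTpos, ENNReal.ofReal_natCast,
      ENNReal.ofReal_natCast, div_eq_mul_inv, mul_comm]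
  rw [hr, hr']
  have hT0 : ((L - LF + 1 : ℕ) : ℝ≥0∞) ≠ 0 := by simp
  have hTt : ((L - LF + 1 : ℕ) : ℝ≥0∞) ≠ ∞ := ENNReal.natCast_ne_top _
  have hK0 : (Fintype.card (StartIndices L LF 1 B) : ℝ≥0∞) ≠ 0 := by simp
  have hKt : (Fintype.card (StartIndices L LF 1 B) : ℝ≥0∞) ≠ ∞ := ENNReal.natCast_ne_top _
  change (Fintype.card (StartIndices L LF 1 B) : ℝ≥0∞) * _ = _ * ∑ τ, F τ at hsum
  generalize ((L - LF + 1 : ℕ) : ℝ≥0∞) = T at *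
  generalize (Fintype.card (StartIndices L LF 1 B) : ℝ≥0∞) = K at *
  calc K⁻¹ * ∑ τ, F τ = K⁻¹ * (T⁻¹ * T) * ∑ τ, F τ := by
        rw [ENNReal.inv_mul_cancel hT0 hTt, mul_one]
    _ = K⁻¹ * T⁻¹ * (T * ∑ τ, F τ) := by ring
    _ = T⁻¹ * (K⁻¹ * K) * ((LC + LF : ℕ) * I₂ + (L - LF + 1 - (LC + LF) : ℕ) * I₀) := by
        rw [← hsum]; ring
    _ = _ := by rw [ENNReal.inv_mul_cancel hK0 hKt]; ring

/-- The continuation is a probability measure, so the later gradients integrate out. -/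
lemma lintegral_stepsLaw_first (m : ForecastModel D LC LF) (lam Lam : ℕ)
    (C : ℝ) (σ : ℝ≥0) (η : ℝ) (x : Dataset N L) {k : ℕ} (hk : 0 < k) (b : ℕ) (θ : Param D)
    {φ : Param D → ℝ≥0∞} (hφ : Measurable φ) :
    ∫⁻ o, φ (o ⟨0, hk⟩) ∂stepsLaw m lam Lam C σ η x k b θ =
      ∫⁻ g, φ g ∂stepLaw m lam Lam C σ x (topLevelBatch N (Lam / lam) b) θ := by
  obtain ⟨k, rfl⟩ := Nat.exists_eq_succ_of_ne_zero hk.ne'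
  rw [lintegral_stepsLaw_succ (φ := fun o => φ (o ⟨0, hk⟩)) _ _ _ _ _ _ _ _ _ _
    (hφ.comp (measurable_pi_apply _))]
  refine lintegral_congr fun g => ?_
  simp

lemma tightProfile_le_privacyProfile {Lam : ℕ} (hLam : 0 < Lam) (hN : Lam ≤ N)
    (hLF : 0 < LF) (hL : LC + LF + LF ≤ L + 1) {C : ℝ} (hC : 0 < C) {σ : ℝ≥0} (hσ : 0 < σ)
    (η : ℝ) (θ₀ : Param D) {e : Param D} (he : ‖e‖ = 1) (α : ℝ≥0) :
    tightProfile L LC LF σ α ≤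
      privacyProfile N L (detectorModel LC LF e C) 1 Lam C σ η θ₀ α := by
  have := isProbabilityMeasure_mixtureP σ hLF hL
  let s : Fin L := ⟨LF - 1, by omega⟩
  have hs : (s : ℕ) + 1 = LF := by simp only [s]; omega
  have hK : 0 < N * 1 / Lam := Nat.div_pos (by omega) hLam
  -- The changed series is put in the first batch, so the first released gradient alone carries the
  -- whole divergence.
  let n : topLevelBatch N (Lam / 1) 0 := ⟨⟨0, by omega⟩, by simp [topLevelBatch, hLam]⟩
  let T : (Fin (N * 1 / Lam) → Param D) → ℝ := fun o =>
    directionalStatistic Lam (topLevelBatch N (Lam / 1) 0).card C e (o ⟨0, hK⟩)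
  have hT : Measurable T :=
    (measurable_directionalStatistic _ _ _ _).comp (measurable_pi_apply _)
  have hP : ∀ A : Set ℝ, MeasurableSet A →
      epochLaw (detectorModel LC LF e C) 1 Lam C σ η θ₀ (spikedDataset (n : Fin N) s) (T ⁻¹' A) =
        mixtureP L LC LF σ A := fun A hA => by
    have hψ : Measurable (A.indicator (1 : ℝ → ℝ≥0∞)) := measurable_one.indicator hA
    rw [← lintegral_indicator_one hA, ← lintegral_stepLaw_spikedDataset hLam hC he σ hL hs n
      θ₀ hψ, ← lintegral_indicator_one (hT hA)]
    exact lintegral_stepsLaw_first (detectorModel LC LF e C) 1 Lam C σ η _ hK 0 θ₀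
      (hψ.comp (measurable_directionalStatistic _ _ _ _))
  have hQ : ∀ A : Set ℝ, MeasurableSet A →
      epochLaw (detectorModel LC LF e C) 1 Lam C σ η θ₀ (constantDataset N L s) (T ⁻¹' A) =
        gaussianReal 0 (σ ^ 2) A := fun A hA => by
    have hψ : Measurable (A.indicator (1 : ℝ → ℝ≥0∞)) := measurable_one.indicator hA
    rw [← lintegral_indicator_one hA, ← lintegral_stepLaw_constantDataset (LC := LC) (LF := LF)
      hLam hC he σ s (topLevelBatch N (Lam / 1) 0) θ₀ hψ, ← lintegral_indicator_one (hT hA)]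
    exact lintegral_stepsLaw_first (detectorModel LC LF e C) 1 Lam C σ η _ hK 0 θ₀
      (hψ.comp (measurable_directionalStatistic _ _ _ _))
  have hx : ∀ k, k ≠ (n : Fin N) → spikedDataset (n : Fin N) s k = constantDataset N L s k :=
    fun k hk => spikedDataset_of_ne s hk
  have hset : ∀ {P Q : Measure (Fin (N * 1 / Lam) → Param D)} [IsProbabilityMeasure P]
      [IsProbabilityMeasure Q], P ≪ Q → ∀ A : Set ℝ, MeasurableSet A →
      P (T ⁻¹' A) ≤ α * Q (T ⁻¹' A) + hockeyStick α P Q := fun {P Q} _ _ hPQ A hA => by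
    rw [← lintegral_indicator_one (hT hA), ← lintegral_indicator_one (hT hA)]
    exact lintegral_le_hockeyStick hPQ α (measurable_one.indicator (hT hA))
      fun o => Set.indicator_le_self' (fun _ _ => zero_le) _
  by_cases hα : 1 ≤ α
  · rw [tightProfile_of_one_le hα]
    refine le_trans ?_ (le_iSup_of_le (spikedDataset (n : Fin N) s)
      (le_iSup_of_le (constantDataset N L s)
        (le_iSup_of_le (eventNeighbor_spikedDataset _ s).1 le_rfl)))
    -- Data processing: a test set for the real statistic pulls back along `T` to a test set for the
    -- epoch output.
    refine hockeyStick_le fun A hA => ?_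
    rw [← hP A hA, ← hQ A hA]
    exact hset (stepsLaw_absolutelyContinuous hC hσ hx _ _ _) A hA
  · rw [tightProfile_of_not_one_le hα]
    refine le_trans ?_ (le_iSup_of_le (constantDataset N L s)
      (le_iSup_of_le (spikedDataset (n : Fin N) s)
        (le_iSup_of_le (eventNeighbor_spikedDataset _ s).2 le_rfl)))
    refine hockeyStick_le fun A hA => ?_
    rw [← hP A hA, ← hQ A hA]
    exact hset (stepsLaw_absolutelyContinuous hC hσ (fun k hk => (hx k hk).symm) _ _ _) A hA

end WorstCase

end DPForecast

open DPForecast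
theorem theorem4p2 (N L LC LF D Lam : ℕ) (hD : 0 < D) (hLam : 0 < Lam) (hN : Lam ≤ N)
    (hLF : 0 < LF) (hL : LC + LF + LF ≤ L + 1)
    (C : ℝ) (hC : 0 < C) (σ : ℝ≥0) (hσ : 0 < σ) (η : ℝ) (θ₀ : Param D) :
    (∀ α : ℝ≥0, (⨆ m : ForecastModel D LC LF, privacyProfile N L m 1 Lam C σ η θ₀ α) =
      tightProfile L LC LF σ α) ∧
    ∃ m : ForecastModel D LC LF, ∀ α : ℝ≥0,
      privacyProfile N L m 1 Lam C σ η θ₀ α = tightProfile L LC LF σ α := by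
  have he : ‖(EuclideanSpace.single ⟨0, hD⟩ 1 : Param D)‖ = 1 := by simp
  have hle : ∀ α, tightProfile L LC LF σ α ≤ privacyProfile N L
      (detectorModel LC LF (EuclideanSpace.single ⟨0, hD⟩ 1) C) 1 Lam C σ η θ₀ α :=
    tightProfile_le_privacyProfile hLam hN hLF hL hC hσ η θ₀ he
  exact ⟨fun α => le_antisymm (iSup_le fun m => privacyProfile_le hC hσ hLF hL α)
      ((hle α).trans (le_iSup (fun m : ForecastModel D LC LF =>
        privacyProfile N L m 1 Lam C σ η θ₀ α) _)),
    _, fun α => le_antisymm (privacyProfile_le hC hσ hLF hL α) (hle α)⟩
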